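/- **Theorem 1.** *Model.* Let $w^*\in[0,1]^D$ be an unknown database vector, let $U$ be a known $d$-dimensional linear subspace of $\mathbb{R}^D$, $1\le d<D$, and let $\mathcal D$ be an unknown probability distribution on the nonzero vectors of $U\cap[0,1]^D$. Let $\mathcal E$ be a known noise distribution on a bounded interval $[-u,u]$ without atoms. In rounds $t=1,\dots,T$ a query $q^t$ is drawn from $\mathcal D$ and a noise value $\epsilon^t=D\,\eta^t$ with $\eta^t\sim\mathcal E$ is drawn, all draws being independent. The algorithm sees $q^t$, outputs an answer $z^t\in\mathbb{R}$ and one threshold $\theta^t\in\mathbb{R}$, and then receives the single bit that tells whether $w^*\cdot q^t+\epsilon^t>\theta^t$. Between rounds it keeps only its memory, a string of $k$ bits; $z^t$ and $\theta^t$ are functions of this memory and of $q^t$, and the memory is updated from itself, $q^t$ and the received bit. Its average error is $e_{av}=\frac1T\sum_{t=1}^T|z^t-w^*\cdot q^t|$. Let $\phi=2\arcsin\!\big(\frac1{64\sqrt d}\big)$. For an orthonormal basis $B$ of $U$ let $$p=p_{\mathcal D,\phi}=\min_{e\in B}\ \mathbb P_{q\sim\mathcal D}\Big(e\cdot \tfrac{q}{\|q\|_2}\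 \ge\ \cos\phi\Big),\qquad r=\frac{2}{p^2}.$$ *Claim.* For every $\mathcal E$ there is a constant $C>0$, depending only on $\mathcal E$, and for all $1\le d<D$ there is a constant $M>0$, depending only on $\mathcal E,d,D$, such that for every $T\ge1$ and every $d$-dimensional subspace $U$ of $\mathbb R^D$ there is a deterministic algorithm of this kind, with memory of at most $M\log T$ bits, for which the following holds for every $w^*\in[0,1]^D$, every $\mathcal D$ as above and every orthonormal basis $B$ of $U$ with $p_{\mathcal D,\phi}>0$: $$e_{av}\ \le\ C\cdot\frac{1}{\sqrt T}\Big(r\,D^{7/2}\,d+\sqrt D\,\log T\Big)$$ with probability at least $$1-C\Big(\frac{\log(dDT)}{T^3}+\frac{d\log(dT)}{T^{30}}\Big).$$ -/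

import Mathlib

open MeasureTheory

/-- Query vectors and database vectors: `ℝ^D` with the Euclidean norm. -/
abbrev Vec (D : ℕ) : Type := EuclideanSpace ℝ (Fin D)

/-- All coordinates lie in `[0,1]`. -/
def InUnitCube {D : ℕ} (v : Vec D) : Prop := ∀ i, 0 ≤ v i ∧ v i ≤ 1

/-- The binary oracle: answers whether the noisy value `a` is greater than the threshold `θ`. -/
noncomputable def binaryOracle (a θ : ℝ) : Bool := by
  classical exact decide (θ < a)

/-- A deterministic online learning algorithm whose whole memory between two rounds is `k` bits.
In each round it sees the query; from its memory and the query alone it computes the answer to the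
query and the threshold for the oracle. The bit returned by the oracle can only be used to
update the memory. The query is not available any more in later rounds, and neither is the
index of the round, unless the algorithm stores it. -/
structure OnlineLearner (D k : ℕ) where
  init : Fin k → Bool
  answer : (Fin k → Bool) → Vec D → ℝ
  threshold : (Fin k → Bool) → Vec D → ℝ
  update : (Fin k → Bool) → Vec D → Bool → (Fin k → Bool)
  measurable_answer : ∀ s, Measurable (answer s)
  measurable_threshold : ∀ s, Measurable (threshold s)
  measurable_update : ∀ s b, Measurable fun q => update s q b

namespace OnlineLearner

variable {D k : ℕ}

/-- One round for the database `w`: `x.1` is the query and `x.2` is the value of the normalized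
noise, so that the database mechanism computes the noisy answer `w ⬝ q + D * x.2`. The oracle
is accessed exactly once. -/
noncomputable def step (A : OnlineLearner D k) (w : Vec D) (s : Fin k → Bool) (x : Vec D × ℝ) :
    Fin k → Bool :=
  A.update s x.1 (binaryOracle (inner ℝ w x.1 + (D : ℝ) * x.2) (A.threshold s x.1))

/-- The memory after `t` rounds on a stream of `T` queries (with noise). -/
noncomputable def memoryAfter (A : OnlineLearner D k) (w : Vec D) {T : ℕ}
    (x : Fin T → Vec D × ℝ) : ℕ → (Fin k → Bool)
  | 0 => A.init
  | t + 1 =>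
    if h : t < T then A.step w (A.memoryAfter w x t) (x ⟨t, h⟩) else A.memoryAfter w x t

/-- The average error `(1/T) ∑ₜ |zₜ - w ⬝ qₜ|` of the algorithm on a stream of `T` queries. -/
noncomputable def averageError (A : OnlineLearner D k) (w : Vec D) {T : ℕ}
    (x : Fin T → Vec D × ℝ) : ℝ :=
  (1 / (T : ℝ)) *
    ∑ t : Fin T, |A.answer (A.memoryAfter w x t) (x t).1 - inner ℝ w (x t).1|

end OnlineLearner

/-- The law of a stream of `T` rounds: queries i.i.d. from `𝒟`, normalized noise i.i.d. from `ν`,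
queries and noise independent of each other. -/
noncomputable def streamLaw {D : ℕ} (T : ℕ) (𝒟 : Measure (Vec D)) (ν : Measure ℝ) :
    Measure (Fin T → Vec D × ℝ) :=
  Measure.pi fun _ => 𝒟.prod ν

/-- The law of `q / ‖q‖₂` for `q` distributed according to `𝒟`. -/
noncomputable def normalizedLaw {D : ℕ} (𝒟 : Measure (Vec D)) : Measure (Vec D) :=
  𝒟.map fun q => (‖q‖⁻¹ : ℝ) • q

/-- The probability that a vector `x` with law `Q` (on the unit sphere) satisfies
`e ⬝ x ≥ cos θ`. -/
noncomputable def capProb {D : ℕ} (Q : Measure (Vec D)) (e : Vec D) (θ : ℝ) : ℝ :=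
  Q.real {x | Real.cos θ ≤ inner ℝ e x}

/-- `p_{𝒟,θ}`: the minimum of the cap probabilities of the normalized law of the queries
around the vectors of the orthonormal basis `B` of `U`. -/
noncomputable def minCapProb {D d : ℕ} {U : Submodule ℝ (Vec D)} (𝒟 : Measure (Vec D))
    (B : OrthonormalBasis (Fin d) ℝ U) (θ : ℝ) : ℝ :=
  ⨅ i : Fin d, capProb (normalizedLaw 𝒟) (B i : Vec D) θ

/-- The angle `φ = 2 arcsin (1 / (64 √d))`. -/
noncomputable def capAngle (d : ℕ) : ℝ := 2 * Real.arcsin (1 / (64 * √(d : ℝ)))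

/-! The learner is an online Newton method fed by one-bit feedback, with its state rounded to a
polynomial grid. Write `e` for the current error, answer minus true value.

Noise. The quantile function of the noise is monotone, hence differentiable somewhere in `(0,1)`,
and there it obeys a linear bound. Inverted, this gives a point `m` around which the noise tail
decreases at least linearly, with slope `c` (`exists_tail_linear_decay`). With the threshold at the
answer plus `D * m`, the bit minus its probability at `e = 0`, scaled by `β = D / c`, is a feedback
`y` with `e * E[y] ≤ -e ^ 2`.

Newton step. Let `A` be the identity plus the Gram matrix of the past queries. A Newton step raises
the squared distance to `w` in the growing metric `A` by at most `e ^ 2 + 2 * e * y` plus a multiple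
of `y ^ 2` that is paid for by the growth of `log det A` (`quadForm_newton_le`,
`div_one_add_le_log_det_sub`). So the potential, squared distance minus `β ^ 2 * log det A`, drifts
down by about `e ^ 2` in each round. It starts at or below `D` and never falls below `-3 * D * β ^ 2
* log T`.

Concentration. For a small multiple of the potential plus half the sum of the squared errors, the
exponential is a supermartingale up to rounding (`two_point_exp_le_one`,
`lintegral_prod_memoryAfter_le`). Markov's inequality bounds the sum of squares by `O(D ^ 3 * log
T)`, the constant depending on `c`, outside an event of probability `1 / T ^ 3`.

Conclusion. Cauchy–Schwarz passes to the average error. Since `p ≤ 1` gives `r ≥ 2`, the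
arithmetic-geometric mean inequality places the result below the claimed sum. Rounding to the grid
of mesh `T ^ (-9)` costs `1 / T` per round and keeps all stored integers below `T ^ 20`, hence `O(D
^ 2 * log T)` bits. For `T` below a multiple of `D ^ 5 / c ^ 2` the claimed error exceeds `D`, and
always answering `0` is enough. -/

open Matrix

/-! ### Noise: a point where the tail decreases linearly -/

/-- A monotone function is Lipschitz around its points of differentiability, hence satisfies a
global linear bound there if it is bounded. -/
theorem exists_linear_bound_of_differentiableAt {Q : ℝ → ℝ} {y₀ R : ℝ} 
    (hb : ∀ y, |Q y| ≤ R) (hd : DifferentiableAt ℝ Q y₀) :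
    ∃ L : ℝ, 0 < L ∧ ∀ y, |Q y - Q y₀| ≤ L * |y - y₀| := by
  obtain ⟨K, hK⟩ := hd.isBigO_sub.bound
  obtain ⟨δ, hδ, hball⟩ := Metric.eventually_nhds_iff.1 hK
  -- The derivative controls the `δ`-ball; outside it `2 * R` is at most `2 * R / δ` times the
  -- distance.
  refine ⟨max (|K| + 1) (2 * R / δ), by positivity, fun y => ?_⟩
  by_cases hy : dist y y₀ < δ
  · have h := hball hy
    simp only [Real.norm_eq_abs] at h
    calc |Q y - Q y₀| ≤ K * |y - y₀| := h
      _ ≤ max (|K| + 1) (2 * R / δ) * |y - y₀| := by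
        gcongr
        exact le_max_of_le_left ((le_abs_self K).trans (by linarith))
  · have h1 : |Q y - Q y₀| ≤ 2 * R := by
      have := abs_sub (Q y) (Q y₀)
      linarith [hb y, hb y₀]
    rw [not_lt, Real.dist_eq] at hy
    calc |Q y - Q y₀| ≤ 2 * R := h1
      _ = 2 * R / δ * δ := by field_simp
      _ ≤ max (|K| + 1) (2 * R / δ) * |y - y₀| := by
        gcongr
        exact le_max_right _ _

/-- A continuous monotone function that rises from `0` to `1` on `[-a, a]` has a point at which it
grows at least linearly. -/
theorem exists_linear_growth {F : ℝ → ℝ} (hF : Monotone F) (hc : Continuous F) {a : ℝ}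
    (ha : 0 ≤ a) (h0 : ∀ x, x ≤ -a → F x = 0) (h1 : ∀ x, a ≤ x → F x = 1) :
    ∃ m c : ℝ, 0 < c ∧ c ≤ 1 ∧ ∀ x, |x| ≤ 1 → c * x ^ 2 ≤ x * (F (m + x) - F m) := by
  -- The margin `1` keeps `m + x` in `[-b, b]` for `m ∈ [-a, a]` and `|x| ≤ 1`. `Q` is the
  -- generalized inverse of `F` on this interval; the point `-b` is put into every `S y` so that no
  -- supremum is over the empty set.
  set b : ℝ := a + 1 with hbdef
  set S : ℝ → Set ℝ := fun y => {x | x ∈ Set.Icc (-b) b ∧ (x = -b ∨ F x ≤ y)} with hS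
  set Q : ℝ → ℝ := fun y => sSup (S y) with hQ
  have hne : ∀ y, (S y).Nonempty := fun y => ⟨-b, ⟨⟨le_rfl, by linarith⟩, Or.inl rfl⟩⟩
  have hbd : ∀ y, BddAbove (S y) := fun y => ⟨b, fun x hx => hx.1.2⟩
  have hQlo : ∀ y, -b ≤ Q y := fun y =>
    le_csSup (hbd y) ⟨⟨le_rfl, by linarith⟩, Or.inl rfl⟩
  have hQhi : ∀ y, Q y ≤ b := fun y => csSup_le (hne y) fun x hx => hx.1.2
  have hQmono : Monotone Q := fun y y' hyy =>
    csSup_le_csSup (hbd y') (hne y) fun x hx => ⟨hx.1, hx.2.imp_right fun h => h.trans hyy⟩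
  have hle : ∀ x ∈ Set.Icc (-b) b, x ≤ Q (F x) := fun x hx =>
    le_csSup (hbd _) ⟨hx, Or.inr le_rfl⟩
  have hge : ∀ x ∈ Set.Icc (-b) b, ∀ y < F x, Q y ≤ x := fun x hx y hy =>
    csSup_le (hne y) fun x' hx' => by
      rcases hx'.2 with h | h
      · rw [h]; exact hx.1
      · by_contra hlt
        exact absurd (hF (not_le.1 hlt).le) (not_le.2 (h.trans_lt hy))
  -- Lebesgue's theorem: a monotone function is differentiable almost everywhere.
  obtain ⟨y₀, hy₀, hd⟩ : ∃ y ∈ Set.Ioo (0 : ℝ) 1, DifferentiableAt ℝ Q y := by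
    by_contra hcon
    push Not at hcon
    have hae := hQmono.ae_differentiableAt
    have : volume (Set.Ioo (0 : ℝ) 1) = 0 :=
      measure_mono_null (fun y hy => hcon y hy) (ae_iff.1 hae)
    simp at this
  obtain ⟨L, hL, hbound⟩ := exists_linear_bound_of_differentiableAt (R := b)
    (fun y => abs_le.2 ⟨hQlo y, hQhi y⟩) hd
  set m := Q y₀ with hm
  have hgt : ∀ x ∈ Set.Icc (-b) b, m < x → y₀ < F x := fun x hx hmx => by
    by_contra hcon
    exact absurd (le_csSup (hbd y₀) ⟨hx, Or.inr (not_lt.1 hcon)⟩) (not_le.2 hmx)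
  have hlt : ∀ x ∈ Set.Icc (-b) b, x < m → F x ≤ y₀ := fun x hx hxm => by
    by_contra hcon
    exact absurd (hge x hx y₀ (not_le.1 hcon)) (not_le.2 hxm)
  have hma : m ≤ a := hge a ⟨by linarith, by linarith⟩ y₀ (by rw [h1 a le_rfl]; exact hy₀.2)
  have hma' : -a ≤ m := le_csSup (hbd y₀)
    ⟨⟨by linarith, by linarith⟩, Or.inr (by rw [h0 _ le_rfl]; exact hy₀.1.le)⟩
  have hFm : F m = y₀ := by
    apply le_antisymm
    · refine le_of_tendsto (hc.continuousWithinAt (s := Set.Iio m) (x := m)) ?_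
      have : Set.Ioo (m - 1) m ∈ nhdsWithin m (Set.Iio m) :=
        Ioo_mem_nhdsLT (by linarith)
      filter_upwards [this] with x hx
      exact hlt x ⟨by linarith [hx.1], by linarith [hx.2]⟩ hx.2
    · refine ge_of_tendsto (hc.continuousWithinAt (s := Set.Ioi m) (x := m)) ?_
      have : Set.Ioo m (m + 1) ∈ nhdsWithin m (Set.Ioi m) :=
        Ioo_mem_nhdsGT (by linarith)
      filter_upwards [this] with x hx
      exact (hgt x ⟨by linarith [hx.1], by linarith [hx.2]⟩ hx.1).le
  have key : ∀ x, |x| ≤ 1 → |x| ≤ L * |F (m + x) - F m| := by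
    intro x hx
    rw [abs_le] at hx
    have hmem : m + x ∈ Set.Icc (-b) b := ⟨by linarith [hx.1], by linarith [hx.2]⟩
    rw [hFm]
    rcases lt_trichotomy x 0 with hneg | rfl | hpos
    · have h2 := hlt _ hmem (by linarith)
      rw [abs_of_neg hneg, abs_of_nonpos (by linarith)]
      -- To the left of `m`, `Q y ≤ m + x` is known only for `y` strictly below `F (m + x)`; hence
      -- the slack `ε / L`.
      refine le_of_forall_pos_le_add fun ε hε => ?_
      have h3 := hge _ hmem (F (m + x) - ε / L) (by
        have : 0 < ε / L := by positivity
        linarith)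
      have h4 := hbound (F (m + x) - ε / L)
      have h5 : 0 < ε / L := by positivity
      rw [abs_of_nonpos (a := F (m + x) - ε / L - y₀) (by linarith)] at h4
      have h6 := neg_abs_le (Q (F (m + x) - ε / L) - m)
      have h7 : L * (ε / L) = ε := by field_simp
      nlinarith
    · simp; positivity
    · have h2 := hgt _ hmem (by linarith)
      rw [abs_of_pos hpos, abs_of_pos (by linarith)]
      have h3 := hle _ hmem
      have h4 := hbound (F (m + x))
      rw [abs_of_pos (a := F (m + x) - y₀) (by linarith)] at h4
      linarith [le_abs_self (Q (F (m + x)) - m)]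
  refine ⟨m, min 1 (1 / L), by positivity, min_le_left _ _, fun x hx => ?_⟩
  have hprod : x * (F (m + x) - F m) = |x| * |F (m + x) - F m| := by
    rw [← abs_mul, abs_of_nonneg]
    rcases le_total 0 x with h | h
    · exact mul_nonneg h (sub_nonneg.2 (hF (by linarith)))
    · exact mul_nonneg_of_nonpos_of_nonpos h (sub_nonpos.2 (hF (by linarith)))
  have h2 : 1 / L * |x| ≤ |F (m + x) - F m| := by
    have := key x hx
    rw [one_div, inv_mul_le_iff₀ hL]
    exact this
  rw [hprod, ← sq_abs]
  calc min 1 (1 / L) * |x| ^ 2 ≤ 1 / L * |x| ^ 2 := by gcongr; exact min_le_right _ _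
    _ = |x| * (1 / L * |x|) := by ring
    _ ≤ |x| * |F (m + x) - F m| := by gcongr

/-- The tail function of an atomless law with bounded support has a point at which it decreases
at least linearly. -/
theorem exists_tail_linear_decay (u : ℝ) (ν : Measure ℝ) [IsProbabilityMeasure ν]
    (hatom : ∀ c : ℝ, ν {c} = 0) (hν : ∀ᵐ e ∂ν, e ∈ Set.Icc (-u) u) :
    ∃ m c : ℝ, 0 < c ∧ c ≤ 1 ∧
      ∀ x, |x| ≤ 1 →
        x * (ν.real (Set.Ioi (m + x)) - ν.real (Set.Ioi m)) ≤ -(c * x ^ 2) := by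
  set F : ℝ → ℝ := fun x => ν.real (Set.Iic x) with hFdef
  have hF : F = ProbabilityTheory.cdf ν := by
    ext x; rw [ProbabilityTheory.cdf_eq_real]
  have hmono : Monotone F := hF ▸ ProbabilityTheory.monotone_cdf ν
  have hcont : Continuous F := by
    rw [continuous_iff_continuousAt]
    intro x
    rw [hF, (ProbabilityTheory.monotone_cdf ν).continuousAt_iff_leftLim_eq_rightLim,
      StieltjesFunction.rightLim_eq]
    have := (ProbabilityTheory.cdf ν).measure_singleton x
    rw [ProbabilityTheory.measure_cdf, hatom, eq_comm, ENNReal.ofReal_eq_zero] at this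
    exact le_antisymm ((ProbabilityTheory.monotone_cdf ν).leftLim_le le_rfl) (by linarith)
  have h0 : ∀ x, x ≤ -|u| → F x = 0 := by
    intro x hx
    have : ν (Set.Iic x) = 0 := by
      -- The endpoint `-u` may lie in the support, but it is not an atom.
      refine measure_mono_null (t := {e | ¬ e ∈ Set.Icc (-u) u} ∪ {-u}) ?_ ?_
      · intro e he
        by_cases h : e ∈ Set.Icc (-u) u
        · right
          have h1 : e ≤ -|u| := le_trans he hx
          exact le_antisymm (by linarith [le_abs_self u]) h.1
        · exact Or.inl h
      · exact measure_union_null (ae_iff.1 hν) (hatom _)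
    simp [hFdef, Measure.real, this]
  have h1 : ∀ x, |u| ≤ x → F x = 1 := by
    intro x hx
    have : ν (Set.Iic x) = 1 := by
      rw [← mem_ae_iff_prob_eq_one measurableSet_Iic]
      filter_upwards [hν] with e he
      exact he.2.trans ((le_abs_self u).trans hx)
    simp [hFdef, Measure.real, this]
  obtain ⟨m, c, hc0, hc1, h⟩ := exists_linear_growth hmono hcont (abs_nonneg u) h0 h1
  refine ⟨m, c, hc0, hc1, fun x hx => ?_⟩
  have htail : ∀ y, ν.real (Set.Ioi y) = 1 - F y := fun y => by
    rw [← Set.compl_Iic, probReal_compl_eq_one_sub measurableSet_Iic]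
  rw [htail, htail]
  linarith [h x hx]

/-! ### The Newton step in the language of quadratic forms -/

section QuadraticForm

variable {n : Type*} [Fintype n]

/-- The quadratic form `h ↦ hᵀ A h`. -/
def quadForm (A : Matrix n n ℝ) (h : n → ℝ) : ℝ := h ⬝ᵥ A *ᵥ h

theorem quadForm_add_smul {A : Matrix n n ℝ} (hA : Aᵀ = A) {q y : n → ℝ} (hy : A *ᵥ y = q)
    (h : n → ℝ) (a : ℝ) :
    quadForm A (h + a • y) = quadForm A h + 2 * a * (h ⬝ᵥ q) + a ^ 2 * (q ⬝ᵥ y) := by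
  have h1 : y ⬝ᵥ A *ᵥ h = h ⬝ᵥ q := by
    rw [dotProduct_mulVec, ← mulVec_transpose, hA, hy, dotProduct_comm]
  unfold quadForm
  rw [mulVec_add, mulVec_smul, hy, add_dotProduct, dotProduct_add, dotProduct_add, smul_dotProduct,
    smul_dotProduct, dotProduct_smul, dotProduct_smul, h1, dotProduct_comm y q]
  simp only [smul_eq_mul]
  ring

theorem quadForm_add_vecMulVec (A : Matrix n n ℝ) (q h : n → ℝ) :
    quadForm (A + vecMulVec q q) h = quadForm A h + (h ⬝ᵥ q) ^ 2 := by
  unfold quadForm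
  rw [add_mulVec, dotProduct_add, vecMulVec_mulVec, dotProduct_smul, dotProduct_comm q h]
  simp [sq]

theorem quadForm_eq_sum (A : Matrix n n ℝ) (h : n → ℝ) :
    quadForm A h = ∑ i, ∑ j, A i j * (h i * h j) := by
  unfold quadForm
  simp only [dotProduct, mulVec, Finset.mul_sum]
  exact Finset.sum_congr rfl fun i _ => Finset.sum_congr rfl fun j _ => by ring

/-- This bounds the cost of rounding the estimate: `e` will be the rounding error. -/
theorem quadForm_add_le (A : Matrix n n ℝ) (h e : n → ℝ) {a H ε : ℝ}
    (hA : ∀ i j, |A i j| ≤ a) (hH : ∀ i, |h i| ≤ H) (he : ∀ i, |e i| ≤ ε) :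
    quadForm A (h + e) ≤ quadForm A h + (Fintype.card n : ℝ) ^ 2 * (a * (ε * (2 * H + ε))) := by
  rw [← sub_le_iff_le_add', quadForm_eq_sum, quadForm_eq_sum, ← Finset.sum_sub_distrib]
  have hterm : ∀ i j, A i j * ((h + e) i * (h + e) j) - A i j * (h i * h j)
      ≤ a * (ε * (2 * H + ε)) := by
    intro i j
    have hH0 := (abs_nonneg _).trans (hH i)
    have he0 := (abs_nonneg _).trans (he i)
    have ha0 := (abs_nonneg _).trans (hA i j)
    calc A i j * ((h + e) i * (h + e) j) - A i j * (h i * h j)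
        = A i j * (h i * e j + e i * h j + e i * e j) := by simp only [Pi.add_apply]; ring
      _ ≤ |A i j| * |h i * e j + e i * h j + e i * e j| := by
        rw [← abs_mul]; exact le_abs_self _
      _ ≤ |A i j| * (|h i| * |e j| + |e i| * |h j| + |e i| * |e j|) := by
        gcongr
        refine (abs_add_three _ _ _).trans ?_
        simp only [abs_mul, le_refl]
      _ ≤ a * (H * ε + ε * H + ε * ε) := by
        gcongr
        · exact hA i j
        · exact hH i
        · exact he j
        · exact he i
        · exact hH j
        · exact he i
        · exact he j
      _ = a * (ε * (2 * H + ε)) := by ring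
  calc ∑ i, (∑ j, A i j * ((h + e) i * (h + e) j) - ∑ j, A i j * (h i * h j))
      = ∑ i, ∑ j, (A i j * ((h + e) i * (h + e) j) - A i j * (h i * h j)) := by
        simp only [Finset.sum_sub_distrib]
    _ ≤ ∑ _i : n, ∑ _j : n, a * (ε * (2 * H + ε)) :=
        Finset.sum_le_sum fun i _ => Finset.sum_le_sum fun j _ => hterm i j
    _ = _ := by simp [sq, mul_assoc]

variable [DecidableEq n]

theorem sq_apply_le_quadForm_one_add {G : Matrix n n ℝ} (hG : G.PosSemidef) (h : n → ℝ) (i : n) :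
    h i ^ 2 ≤ quadForm (1 + G) h := by
  have h1 := hG.dotProduct_mulVec_nonneg h
  rw [star_trivial] at h1
  unfold quadForm
  rw [add_mulVec, dotProduct_add, one_mulVec]
  have h2 : h i ^ 2 ≤ h ⬝ᵥ h := by
    rw [sq]
    exact Finset.single_le_sum (f := fun i => h i * h i) (fun j _ => mul_self_nonneg _)
      (Finset.mem_univ i)
  linarith

theorem quadForm_one_add_nonneg {G : Matrix n n ℝ} (hG : G.PosSemidef) (h : n → ℝ) :
    0 ≤ quadForm (1 + G) h := by
  have h1 := (Matrix.PosSemidef.one.add hG).dotProduct_mulVec_nonneg h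
  rwa [star_trivial] at h1

/-- The matrix determinant lemma for a symmetric rank-one update. -/
theorem det_add_vecMulVec {A : Matrix n n ℝ} (hA : IsUnit A.det) (q : n → ℝ) :
    (A + vecMulVec q q).det = A.det * (1 + q ⬝ᵥ A⁻¹ *ᵥ q) := by
  rw [vecMulVec_eq Unit, det_add_replicateCol_mul_replicateRow hA]
  congr 1
  rw [det_unique]
  change (1 : Matrix Unit Unit ℝ) () () + _ = _
  rw [one_apply_eq]
  congr 1
  rw [Matrix.mul_assoc, mul_apply]
  simp only [replicateRow_apply, dotProduct]
  rfl

/-- The Leibniz expansion has `n!` terms, each at most `a ^ n`, and `n! ≤ n ^ n`. -/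
theorem log_det_le {A : Matrix n n ℝ} (hA : 0 < A.det) {a : ℝ} (ha : ∀ i j, |A i j| ≤ a) :
    Real.log A.det ≤ Fintype.card n * Real.log (Fintype.card n * a) := by
  have h1 := Matrix.det_le (A := A) (abv := AbsoluteValue.abs) (x := a) ha
  rw [AbsoluteValue.abs_apply, abs_of_pos hA, nsmul_eq_mul] at h1
  have hpow : (0 : ℝ) ≤ a ^ Fintype.card n := by
    by_contra hneg
    have : ((Fintype.card n).factorial : ℝ) * a ^ Fintype.card n ≤ 0 :=
      mul_nonpos_of_nonneg_of_nonpos (by positivity) (not_le.1 hneg).le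
    linarith
  calc Real.log A.det ≤ Real.log (((Fintype.card n : ℝ) * a) ^ Fintype.card n) := by
        apply Real.log_le_log hA
        refine h1.trans ?_
        rw [mul_pow]
        gcongr
        exact_mod_cast Nat.factorial_le_pow _
    _ = _ := Real.log_pow _ _

/-- The scalar inequality behind the Newton step: `z` is the truncation of the prediction `v₀`
to `[0, R]`, `ω ∈ [0, R]` the true value, `y` the scaled feedback. -/
theorem newton_scalar_le {x v₀ ω R y : ℝ} (hx : 0 ≤ x) (hx0 : x = 0 → v₀ = 0 ∧ ω = 0)
    (hω : 0 ≤ ω) (hωR : ω ≤ R) :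
    let z := max 0 (min R v₀)
    let a := (z - v₀) / x + y / (1 + x)
    2 * a * (v₀ - ω) + a ^ 2 * x + (v₀ - ω + a * x) ^ 2
      ≤ (z - ω) ^ 2 + 2 * (z - ω) * y + y ^ 2 * (x / (1 + x)) := by
  intro z a
  rcases hx.eq_or_lt with h | h
  · obtain ⟨rfl, rfl⟩ := hx0 h.symm
    have hz : z = 0 := by simp [z, hωR]
    simp [hz, ← h]
  · have h1 : 0 < 1 + x := by linarith
    -- The left side is `(z - ω) ^ 2 - (v₀ - ω) ^ 2`: truncation to an interval containing `ω` does
    -- not increase the distance to `ω`.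
    have hz : (z - v₀) * (2 * (z - ω) - (z - v₀)) ≤ 0 := by
      rcases le_total v₀ 0 with hv | hv
      · have hz : z = 0 := by simp only [z]; rw [min_eq_right (by linarith), max_eq_left hv]
        rw [hz]; nlinarith
      rcases le_total v₀ R with hv' | hv'
      · have hz : z = v₀ := by simp only [z]; rw [min_eq_right hv', max_eq_right hv]
        rw [hz]; simp
      · have hz : z = R := by
          simp only [z]; rw [min_eq_left hv', max_eq_right (by linarith)]
        rw [hz]; nlinarith
    have hid : 2 * a * (v₀ - ω) + a ^ 2 * x + (v₀ - ω + a * x) ^ 2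
        = (z - ω) ^ 2 + 2 * (z - ω) * y + y ^ 2 * (x / (1 + x))
          + (z - v₀) * (2 * (z - ω) - (z - v₀)) / x := by
      simp only [a]
      field_simp
      ring
    rw [hid]
    have := div_nonpos_of_nonpos_of_nonneg hz h.le
    linarith

/-- The length of the Newton step in the direction `A⁻¹ q` for the current estimate `v`, with
answers truncated to `[0, R]` and scaled feedback `y`. -/
noncomputable def newtonLength (A : Matrix n n ℝ) (R : ℝ) (v q : n → ℝ) (y : ℝ) : ℝ :=
  (max 0 (min R (v ⬝ᵥ q)) - v ⬝ᵥ q) / (q ⬝ᵥ A⁻¹ *ᵥ q) + y / (1 + q ⬝ᵥ A⁻¹ *ᵥ q)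

/-- The first part of the step moves the prediction to its truncation, which does not increase the
distance to `w`. The second part is `y` times the new inverse metric applied to `q`, as
Sherman–Morrison gives `A⁻¹ q / (1 + x)` with `x = q ⬝ A⁻¹ q`. If `x = 0` then `q = 0`, and the
division by zero is harmless. -/
theorem quadForm_newton_le {A : Matrix n n ℝ} (hA : A.PosDef) {R : ℝ} (v w q : n → ℝ) (y : ℝ)
    (hω : 0 ≤ w ⬝ᵥ q) (hωR : w ⬝ᵥ q ≤ R) :
    quadForm (A + vecMulVec q q) (v + newtonLength A R v q y • A⁻¹ *ᵥ q - w)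
      ≤ quadForm A (v - w) + (max 0 (min R (v ⬝ᵥ q)) - w ⬝ᵥ q) ^ 2
        + 2 * (max 0 (min R (v ⬝ᵥ q)) - w ⬝ᵥ q) * y
        + y ^ 2 * ((q ⬝ᵥ A⁻¹ *ᵥ q) / (1 + q ⬝ᵥ A⁻¹ *ᵥ q)) := by
  have hsymm : Aᵀ = A := by
    have := hA.isHermitian.eq
    rwa [conjTranspose_eq_transpose_of_trivial] at this
  have hdet : IsUnit A.det := hA.det_pos.ne'.isUnit
  have hy : A *ᵥ (A⁻¹ *ᵥ q) = q := by
    rw [mulVec_mulVec, mul_nonsing_inv A hdet, one_mulVec]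
  have hx : 0 ≤ q ⬝ᵥ A⁻¹ *ᵥ q := by
    have := hA.inv.posSemidef.dotProduct_mulVec_nonneg q
    rwa [star_trivial] at this
  have hx0 : q ⬝ᵥ A⁻¹ *ᵥ q = 0 → v ⬝ᵥ q = 0 ∧ w ⬝ᵥ q = 0 := by
    intro h
    have hq : q = 0 := by
      by_contra hq
      have := hA.inv.dotProduct_mulVec_pos hq
      rw [star_trivial] at this
      linarith
    simp [hq]
  have key := newton_scalar_le (y := y) hx hx0 hω hωR
  dsimp only at key
  set a := newtonLength A R v q y with ha
  have hrw : v + a • A⁻¹ *ᵥ q - w = (v - w) + a • A⁻¹ *ᵥ q := by abel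
  rw [hrw, quadForm_add_vecMulVec, quadForm_add_smul hsymm hy, add_dotProduct, smul_dotProduct,
    sub_dotProduct, dotProduct_comm (A⁻¹ *ᵥ q) q, smul_eq_mul]
  unfold newtonLength at ha
  rw [← ha] at key
  linarith

/-- With `x = q ⬝ A⁻¹ q` the right side is `log (1 + x)`. The quadratic feedback terms thus
telescope into a log-determinant. -/
theorem div_one_add_le_log_det_sub {A : Matrix n n ℝ} (hA : A.PosDef) (q : n → ℝ) :
    (q ⬝ᵥ A⁻¹ *ᵥ q) / (1 + q ⬝ᵥ A⁻¹ *ᵥ q)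
      ≤ Real.log (A + vecMulVec q q).det - Real.log A.det := by
  have hx : 0 ≤ q ⬝ᵥ A⁻¹ *ᵥ q := by
    have := hA.inv.posSemidef.dotProduct_mulVec_nonneg q
    rwa [star_trivial] at this
  set x := q ⬝ᵥ A⁻¹ *ᵥ q with hxdef
  rw [det_add_vecMulVec hA.det_pos.ne'.isUnit, ← hxdef,
    Real.log_mul hA.det_pos.ne' (by positivity), add_sub_cancel_left]
  have h1 : (0 : ℝ) < 1 + x := by linarith
  have := Real.one_sub_inv_le_log_of_pos h1
  calc x / (1 + x) = 1 - (1 + x)⁻¹ := by field_simp; ring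
    _ ≤ _ := this

end QuadraticForm

/-! ### Supermartingales along the memory of a learner -/

section Trajectory

variable {D k : ℕ}

namespace OnlineLearner

/-- The learner started from the memory `s`. -/
def restart (A : OnlineLearner D k) (s : Fin k → Bool) : OnlineLearner D k :=
  { A with init := s }

/-- Splitting off the first round, rather than the last, permits induction over product measures
with the remaining rounds fresh. -/
theorem memoryAfter_succ_eq_restart (A : OnlineLearner D k) (w : Vec D) {T : ℕ}
    (x : Fin (T + 1) → Vec D × ℝ) (t : ℕ) :
    A.memoryAfter w x (t + 1)
      = (A.restart (A.step w A.init (x 0))).memoryAfter w (fun i => x i.succ) t := by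
  induction t with
  | zero => simp [memoryAfter, restart]
  | succ t ih =>
    rw [memoryAfter, ih, memoryAfter]
    by_cases h : t < T
    · rw [dif_pos (by omega), dif_pos h]
      rfl
    · rw [dif_neg (by omega), dif_neg h]

theorem measurable_binaryOracle : Measurable fun x : ℝ × ℝ => binaryOracle x.1 x.2 := by
  refine measurable_to_bool ?_
  have : (fun x : ℝ × ℝ => binaryOracle x.1 x.2) ⁻¹' {true} = {x | x.2 < x.1} := by
    ext x; simp [binaryOracle]
  rw [this]
  exact measurableSet_lt measurable_snd measurable_fst

theorem measurable_step (A : OnlineLearner D k) (w : Vec D) (s : Fin k → Bool) :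
    Measurable (A.step w s) := by
  have h1 : Measurable fun x : Vec D × ℝ =>
      binaryOracle (inner ℝ w x.1 + (D : ℝ) * x.2) (A.threshold s x.1) := by
    refine measurable_binaryOracle.comp (Measurable.prodMk ?_ ?_)
    · fun_prop
    · exact (A.measurable_threshold s).comp measurable_fst
  have h2 : Measurable fun p : Vec D × Bool => A.update s p.1 p.2 :=
    measurable_from_prod_countable_left fun b => A.measurable_update s b
  exact h2.comp (measurable_fst.prodMk h1)

theorem measurable_memoryAfter (A : OnlineLearner D k) (w : Vec D) {T : ℕ} (t : ℕ) :
    Measurable fun x : Fin T → Vec D × ℝ => A.memoryAfter w x t := by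
  induction t with
  | zero => exact measurable_const
  | succ t ih =>
    simp only [memoryAfter]
    by_cases h : t < T
    · simp only [dif_pos h]
      have h2 : Measurable fun p : (Fin k → Bool) × (Vec D × ℝ) => A.step w p.1 p.2 :=
        measurable_from_prod_countable_right fun s => A.measurable_step w s
      exact h2.comp (ih.prodMk (measurable_pi_apply _))
    · simpa only [dif_neg h] using ih

theorem measurable_prod_memoryAfter (A : OnlineLearner D k) (w : Vec D) {T : ℕ}
    {f : (Fin k → Bool) → Vec D × ℝ → ENNReal} (hf : ∀ s, Measurable (f s)) :
    Measurable fun x : Fin T → Vec D × ℝ => ∏ t : Fin T, f (A.memoryAfter w x t) (x t) := by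
  refine Finset.measurable_prod _ fun t _ => ?_
  have h : Measurable fun p : (Fin k → Bool) × (Vec D × ℝ) => f p.1 p.2 :=
    measurable_from_prod_countable_right hf
  exact h.comp ((A.measurable_memoryAfter w t).prodMk (measurable_pi_apply t))

/-- A multiplicative supermartingale bound along the trajectory of a learner. -/
theorem lintegral_prod_memoryAfter_le (A : OnlineLearner D k) (w : Vec D)
    (μ : Measure (Vec D × ℝ)) [IsProbabilityMeasure μ] (G : (Fin k → Bool) → ENNReal)
    (f : (Fin k → Bool) → Vec D × ℝ → ENNReal) (hf : ∀ s x, f s x ≠ ⊤) (T : ℕ) (Inv : ℕ → (Fin k → Bool) → Prop)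
    (h0 : Inv 0 A.init)
    (hstep : ∀ t < T, ∀ s, Inv t s → ∀ᵐ x ∂μ, Inv (t + 1) (A.step w s x))
    (hdrift : ∀ t < T, ∀ s, Inv t s → ∫⁻ x, f s x * G (A.step w s x) ∂μ ≤ G s)
    (hfin : ∀ s, Inv T s → 1 ≤ G s) :
    ∫⁻ x, ∏ t : Fin T, f (A.memoryAfter w x t) (x t) ∂(Measure.pi fun _ : Fin T => μ)
      ≤ G A.init := by
  -- Conditional on the first round, the rest is a shorter run of the restarted learner, with the
  -- invariant shifted by one round.
  induction T generalizing A Inv with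
  | zero => simpa using hfin _ h0
  | succ T ih =>
    have hmp := measurePreserving_piFinSuccAbove (fun _ : Fin (T + 1) => μ) 0
    rw [← hmp.symm.lintegral_comp_emb (MeasurableEquiv.measurableEmbedding _)]
    refine (lintegral_prod_le _).trans ?_
    calc _ = ∫⁻ x, f A.init x * ∫⁻ y, ∏ t : Fin T,
          f ((A.restart (A.step w A.init x)).memoryAfter w y t) (y t)
            ∂(Measure.pi fun _ : Fin T => μ) ∂μ := ?_
      _ ≤ ∫⁻ x, f A.init x * G (A.step w A.init x) ∂μ := ?_
      _ ≤ G A.init := hdrift 0 (by omega) _ h0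
    · refine lintegral_congr fun x => ?_
      rw [← lintegral_const_mul' _ _ (hf _ _)]
      refine lintegral_congr fun y => ?_
      rw [Fin.prod_univ_succ]
      congr 1
      refine Finset.prod_congr rfl fun t _ => ?_
      rw [Fin.val_succ, memoryAfter_succ_eq_restart]
      rfl
    · refine lintegral_mono_ae ?_
      filter_upwards [hstep 0 (by omega) _ h0] with x hx
      gcongr
      exact ih (A.restart (A.step w A.init x)) (fun t s => Inv (t + 1) s) hx
        (fun t ht s hs => hstep (t + 1) (by omega) s hs)
        (fun t ht s hs => hdrift (t + 1) (by omega) s hs) hfin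

end OnlineLearner

end Trajectory

/-! ### Quantized states: invariants, potential and encoding -/

section NewtonState

variable {D : ℕ}

/-- The point of the grid `(1/N) ℤ^D` with the given integer coordinates. -/
noncomputable def gridPoint (N : ℝ) (n : Fin D → ℤ) : Fin D → ℝ := fun i => n i / N

/-- The integer coordinates of the grid point below `v`. -/
noncomputable def gridFloor (N : ℝ) (v : Fin D → ℝ) : Fin D → ℤ := fun i => ⌊N * v i⌋

/-- The matrix with entries in `(1/N²) ℤ` that is encoded by an integer matrix. -/
noncomputable def gridGram (N : ℝ) (G : Matrix (Fin D) (Fin D) ℤ) : Matrix (Fin D) (Fin D) ℝ :=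
  Matrix.of fun i j => (G i j : ℝ) / N ^ 2

theorem gridPoint_gridFloor_mem {N : ℝ} (hN : 0 < N) (v : Fin D → ℝ) (i : Fin D) :
    0 ≤ v i - gridPoint N (gridFloor N v) i ∧ v i - gridPoint N (gridFloor N v) i ≤ 1 / N := by
  have h1 := Int.floor_le (N * v i)
  have h2 := Int.lt_floor_add_one (N * v i)
  have h : v i - gridPoint N (gridFloor N v) i = (N * v i - ⌊N * v i⌋) / N := by
    simp only [gridPoint, gridFloor]
    field_simp
  rw [h]
  exact ⟨div_nonneg (by linarith) hN.le, div_le_div_of_nonneg_right (by linarith) hN.le⟩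

theorem gridPoint_gridFloor_mem_unit {N : ℝ} (hN : 0 < N) {v : Fin D → ℝ} {i : Fin D}
    (hv : 0 ≤ v i ∧ v i ≤ 1) :
    0 ≤ gridPoint N (gridFloor N v) i ∧ gridPoint N (gridFloor N v) i ≤ 1 := by
  refine ⟨?_, by linarith [(gridPoint_gridFloor_mem hN v i).1]⟩
  have : (0 : ℝ) ≤ ⌊N * v i⌋ := by
    exact_mod_cast Int.floor_nonneg.2 (mul_nonneg hN.le hv.1)
  exact div_nonneg this hN.le

theorem gridGram_add_vecMulVec (N : ℝ) (G : Matrix (Fin D) (Fin D) ℤ) (n : Fin D → ℤ) :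
    gridGram N (G + vecMulVec n n)
      = gridGram N G + vecMulVec (gridPoint N n) (gridPoint N n) := by
  ext i j
  simp only [gridGram, gridPoint, vecMulVec_apply, Matrix.add_apply, Matrix.of_apply]
  push_cast
  ring

theorem dotProduct_mem_of_unit {w q : Fin D → ℝ} (hw : ∀ i, 0 ≤ w i ∧ w i ≤ 1)
    (hq : ∀ i, 0 ≤ q i ∧ q i ≤ 1) : 0 ≤ w ⬝ᵥ q ∧ w ⬝ᵥ q ≤ D := by
  constructor
  · exact Finset.sum_nonneg fun i _ => mul_nonneg (hw i).1 (hq i).1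
  · calc w ⬝ᵥ q ≤ ∑ _i : Fin D, (1 : ℝ) := Finset.sum_le_sum fun i _ => by
          nlinarith [hw i, hq i]
      _ = D := by simp

/-- The memory contents of the quantized Newton method: the estimate and the Gram matrix of the
past queries, both in integer coordinates. -/
abbrev NewtonState (D : ℕ) : Type := (Fin D → ℤ) × Matrix (Fin D) (Fin D) ℤ

namespace NewtonState

/-- The positive definite matrix of a state. -/
noncomputable def metric (N : ℝ) (s : NewtonState D) : Matrix (Fin D) (Fin D) ℝ :=
  1 + gridGram N s.2

/-- The answer to the query with integer coordinates `n`. -/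
noncomputable def answer (N : ℝ) (s : NewtonState D) (n : Fin D → ℤ) : ℝ :=
  max 0 (min (D : ℝ) (gridPoint N s.1 ⬝ᵥ gridPoint N n))

/-- One Newton step after the query with integer coordinates `n` and the scaled feedback `y`. -/
noncomputable def newton (N : ℝ) (s : NewtonState D) (n : Fin D → ℤ) (y : ℝ) : NewtonState D :=
  (gridFloor N (gridPoint N s.1 + newtonLength (s.metric N) D (gridPoint N s.1) (gridPoint N n) y
      • (s.metric N)⁻¹ *ᵥ gridPoint N n),
    s.2 + vecMulVec n n)

/-- The squared distance to `w` in the metric of the state. -/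
noncomputable def distSq (N : ℝ) (w : Fin D → ℝ) (s : NewtonState D) : ℝ :=
  quadForm (s.metric N) (gridPoint N s.1 - w)

/-- The potential: squared distance to `w` minus the scaled logarithmic volume. -/
noncomputable def potential (N β : ℝ) (w : Fin D → ℝ) (s : NewtonState D) : ℝ :=
  s.distSq N w - β ^ 2 * Real.log (s.metric N).det

/-- The bounds that hold for the state after `t` of `T` rounds. -/
structure Bounded (N T : ℝ) (w : Fin D → ℝ) (t : ℝ) (s : NewtonState D) : Prop where
  posSemidef : (gridGram N s.2).PosSemidef
  gram_le : ∀ i j, |gridGram N s.2 i j| ≤ t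
  distSq_le : s.distSq N w ≤ T + t * (5 * T ^ 2)

theorem Bounded.metric_posDef {N T t : ℝ} {w : Fin D → ℝ} {s : NewtonState D}
    (h : s.Bounded N T w t) : (s.metric N).PosDef :=
  Matrix.PosDef.one.add_posSemidef h.posSemidef

theorem Bounded.metric_le {N T t : ℝ} {w : Fin D → ℝ} {s : NewtonState D}
    (h : s.Bounded N T w t) (i j : Fin D) : |s.metric N i j| ≤ 1 + t := by
  have h1 : |(1 : Matrix (Fin D) (Fin D) ℝ) i j| ≤ 1 := by
    rw [Matrix.one_apply]; split_ifs <;> simp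
  calc |s.metric N i j| ≤ |(1 : Matrix (Fin D) (Fin D) ℝ) i j| + |gridGram N s.2 i j| :=
        abs_add_le _ _
    _ ≤ 1 + t := add_le_add h1 (h.gram_le i j)

theorem bounded_zero {N T : ℝ} {w : Fin D → ℝ} (hw : ∀ i, 0 ≤ w i ∧ w i ≤ 1) (hD : (D : ℝ) ≤ T) :
    (0 : NewtonState D).Bounded N T w 0 := by
  have hG : gridGram N (0 : NewtonState D).2 = 0 := by
    ext i j; simp [gridGram]
  have hv : gridPoint N (0 : NewtonState D).1 = 0 := by
    ext i; simp [gridPoint]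
  refine ⟨by rw [hG]; exact Matrix.PosSemidef.zero, fun i j => by rw [hG]; simp, ?_⟩
  unfold distSq metric
  rw [hG, hv]
  have := (dotProduct_mem_of_unit hw hw).2
  simp only [quadForm, add_zero, one_mulVec, zero_sub, dotProduct_neg, neg_dotProduct, neg_neg]
  linarith

theorem potential_zero_le {N β : ℝ} {w : Fin D → ℝ} (hw : ∀ i, 0 ≤ w i ∧ w i ≤ 1) :
    potential N β w 0 ≤ D := by
  have hG : gridGram N (0 : NewtonState D).2 = 0 := by
    ext i j; simp [gridGram]
  have hv : gridPoint N (0 : NewtonState D).1 = 0 := by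
    ext i; simp [gridPoint]
  unfold potential distSq metric
  rw [hG, hv]
  have := (dotProduct_mem_of_unit hw hw).2
  simpa [quadForm] using this

/-- One Newton step from a bounded state stays bounded and changes the potential by the
regret-type terms up to a small rounding error. -/
theorem Bounded.newton {N T β t ξ : ℝ} {w : Fin D → ℝ} {s : NewtonState D} {n : Fin D → ℤ}
    (h : s.Bounded N T w t) (hT : 12 ≤ T) (hDT : (D : ℝ) ≤ T) (hN : N = T ^ 9)
    (hβ0 : 0 ≤ β) (hβ : β ≤ T) (ht0 : 0 ≤ t) (ht : t + 1 ≤ T) (hw : ∀ i, 0 ≤ w i ∧ w i ≤ 1)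
    (hn : ∀ i, 0 ≤ gridPoint N n i ∧ gridPoint N n i ≤ 1) (hξ : |ξ| ≤ 1) :
    (s.newton N n (β * ξ)).Bounded N T w (t + 1) ∧
      (s.newton N n (β * ξ)).potential N β w ≤ s.potential N β w
        + (s.answer N n - w ⬝ᵥ gridPoint N n) ^ 2
        + 2 * (s.answer N n - w ⬝ᵥ gridPoint N n) * (β * ξ) + 1 / (2 * T) := by
  have hT0 : 0 < T := by linarith
  have hN0 : 0 < N := by rw [hN]; positivity
  have hω := dotProduct_mem_of_unit hw hn
  set q := gridPoint N n with hq
  set v := gridPoint N s.1 with hv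
  set A := s.metric N with hA
  set z := s.answer N n with hz
  have hzdef : z = max 0 (min (D : ℝ) (v ⬝ᵥ q)) := rfl
  have hz0 : 0 ≤ z := le_max_left _ _
  have hzD : z ≤ D := max_le (by positivity) (min_le_left _ _)
  have hApd : A.PosDef := h.metric_posDef
  have hstep := quadForm_newton_le hApd (R := D) v w q (β * ξ) hω.1 hω.2
  rw [← hzdef] at hstep
  set vn := v + newtonLength A D v q (β * ξ) • A⁻¹ *ᵥ q with hvn
  have hgram : gridGram N (s.newton N n (β * ξ)).2 = gridGram N s.2 + vecMulVec q q :=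
    gridGram_add_vecMulVec N s.2 n
  have hmetric : (s.newton N n (β * ξ)).metric N = A + vecMulVec q q := by
    simp only [metric, hgram, hA, add_assoc]
  have hpsd : (gridGram N (s.newton N n (β * ξ)).2).PosSemidef := by
    rw [hgram]
    have := Matrix.posSemidef_vecMulVec_self_star q
    rw [star_trivial] at this
    exact h.posSemidef.add this
  have hgramle : ∀ i j, |gridGram N (s.newton N n (β * ξ)).2 i j| ≤ t + 1 := by
    intro i j
    rw [hgram]
    refine (abs_add_le _ _).trans (add_le_add (h.gram_le i j) ?_)
    rw [vecMulVec_apply, abs_of_nonneg (mul_nonneg (hn i).1 (hn j).1)]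
    nlinarith [hn i, hn j]
  have hx : 0 ≤ q ⬝ᵥ A⁻¹ *ᵥ q := by
    have := hApd.inv.posSemidef.dotProduct_mulVec_nonneg q
    rwa [star_trivial] at this
  set X := q ⬝ᵥ A⁻¹ *ᵥ q with hX
  have hX0 : 0 ≤ X / (1 + X) := by positivity
  have hX1 : X / (1 + X) ≤ 1 := by rw [div_le_one (by linarith)]; linarith
  have hlog := div_one_add_le_log_det_sub hApd q
  rw [← hX] at hlog
  have hξ2 : (β * ξ) ^ 2 ≤ β ^ 2 := by
    rw [mul_pow, ← sq_abs ξ]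
    exact mul_le_of_le_one_right (sq_nonneg _) (pow_le_one₀ (abs_nonneg _) hξ)
  have hsabs : |z - w ⬝ᵥ q| ≤ T := by
    rw [abs_le]; constructor <;> linarith [hω.1, hω.2]
  have hbξ : |β * ξ| ≤ T := by
    rw [abs_mul, abs_of_nonneg hβ0]
    exact (mul_le_of_le_one_right hβ0 hξ).trans hβ
  -- The three step terms are at most `T ^ 2`, `2 * T ^ 2` and `T ^ 2`. Rounding adds less than `T ^
  -- 2` more, whence the `5 * T ^ 2` per round in the invariant.
  have hpre : quadForm (A + vecMulVec q q) (vn - w) ≤ T + t * (5 * T ^ 2) + 4 * T ^ 2 := by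
    have h1 : (z - w ⬝ᵥ q) ^ 2 ≤ T ^ 2 := sq_le_sq' (by linarith [abs_le.1 hsabs]) (abs_le.1 hsabs).2
    have h2 : (z - w ⬝ᵥ q) * (β * ξ) ≤ T * T :=
      (le_abs_self _).trans (by rw [abs_mul]; gcongr)
    have h3 : (β * ξ) ^ 2 * (X / (1 + X)) ≤ T ^ 2 * 1 :=
      mul_le_mul (hξ2.trans (by gcongr)) hX1 hX0 (by positivity)
    have h4 : quadForm A (v - w) ≤ T + t * (5 * T ^ 2) := h.distSq_le
    nlinarith
  have hpre4 : quadForm (A + vecMulVec q q) (vn - w) ≤ T ^ 4 := by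
    refine hpre.trans ?_
    have h1 : t * (5 * T ^ 2) ≤ (T - 1) * (5 * T ^ 2) := by
      gcongr; linarith
    nlinarith [mul_nonneg hT0.le (sq_nonneg T), pow_pos hT0 3, sq_nonneg T]
  have hvnabs : ∀ i, |(vn - w) i| ≤ T ^ 4 := by
    intro i
    have h1 := sq_apply_le_quadForm_one_add hpsd (vn - w) i
    have h2 : (1 + gridGram N (s.newton N n (β * ξ)).2) = A + vecMulVec q q := hmetric
    rw [h2] at h1
    refine abs_le_of_sq_le_sq (h1.trans (hpre4.trans ?_)) (by positivity)
    rw [← pow_mul]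
    exact pow_le_pow_right₀ (by linarith) (by norm_num)
  -- With entries at most `2 * T`, coordinates at most `T ^ 4` and mesh `T ^ (-9)`, rounding costs
  -- at most `6 / T ^ 2`; `T ≥ 12` turns this into `1 / (2 * T)`.
  have hround : quadForm (A + vecMulVec q q) (gridPoint N (s.newton N n (β * ξ)).1 - w)
      ≤ quadForm (A + vecMulVec q q) (vn - w) + 1 / (2 * T) := by
    set e := gridPoint N (gridFloor N vn) - vn with he
    have heq : gridPoint N (s.newton N n (β * ξ)).1 - w = (vn - w) + e := by
      rw [he]
      change gridPoint N (gridFloor N vn) - w = _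
      abel
    have heabs : ∀ i, |e i| ≤ 1 / N := by
      intro i
      have := gridPoint_gridFloor_mem hN0 vn i
      rw [he, Pi.sub_apply, abs_le]
      constructor <;> linarith [this.1, this.2]
    have hAabs : ∀ i j, |(A + vecMulVec q q) i j| ≤ 2 * T := by
      intro i j
      rw [← hmetric]
      have h1 : |(1 : Matrix (Fin D) (Fin D) ℝ) i j| ≤ 1 := by
        rw [Matrix.one_apply]; split_ifs <;> simp
      refine (abs_add_le _ _).trans ((add_le_add h1 (hgramle i j)).trans ?_)
      linarith
    have h1 := quadForm_add_le (A + vecMulVec q q) (vn - w) e hAabs hvnabs heabs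
    rw [heq]
    refine h1.trans (add_le_add le_rfl ?_)
    rw [Fintype.card_fin]
    have hN1 : 1 / N ≤ T ^ 4 := by
      have : 1 ≤ N := by rw [hN]; exact one_le_pow₀ (by linarith)
      calc 1 / N ≤ 1 := by rw [div_le_one hN0]; exact this
        _ ≤ T ^ 4 := one_le_pow₀ (by linarith)
    calc (D : ℝ) ^ 2 * (2 * T * (1 / N * (2 * T ^ 4 + 1 / N)))
        ≤ T ^ 2 * (2 * T * (1 / N * (2 * T ^ 4 + T ^ 4))) := by gcongr
      _ = 6 / T ^ 2 := by rw [hN]; field_simp; norm_num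
      _ ≤ 1 / (2 * T) := by
        rw [div_le_div_iff₀ (by positivity) (by positivity)]; nlinarith
  have hsmall : 1 / (2 * T) ≤ 1 := by
    rw [div_le_one (by positivity)]; linarith
  refine ⟨⟨hpsd, hgramle, ?_⟩, ?_⟩
  · unfold distSq
    rw [hmetric]
    nlinarith
  · unfold potential distSq
    rw [hmetric]
    have h1 : (β * ξ) ^ 2 * (X / (1 + X))
        ≤ β ^ 2 * (Real.log (A + vecMulVec q q).det - Real.log A.det) :=
      mul_le_mul hξ2 hlog hX0 (sq_nonneg _)
    have h2 : quadForm A (v - w) = s.distSq N w := rfl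
    change _ ≤ quadForm A (v - w) - β ^ 2 * Real.log A.det + _ + _ + _
    linarith

/-- The squared distance is nonnegative, and the determinant of a matrix with entries at most `1 +
T` grows only polynomially in `T`. -/
theorem Bounded.neg_potential_le {N T t β : ℝ} {w : Fin D → ℝ} {s : NewtonState D}
    (h : s.Bounded N T w t) (hT : 2 ≤ T) (hD0 : 0 < D) (hDT : (D : ℝ) ≤ T) (ht : t ≤ T)
    : -s.potential N β w ≤ β ^ 2 * (3 * D * Real.log T) := by
  have h1 := log_det_le h.metric_posDef.det_pos (a := 1 + T)
    (fun i j => (h.metric_le i j).trans (by linarith))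
  rw [Fintype.card_fin] at h1
  have h2 : 0 ≤ s.distSq N w := quadForm_one_add_nonneg h.posSemidef _
  have h3 : Real.log (D * (1 + T)) ≤ 3 * Real.log T := by
    have : 3 * Real.log T = Real.log (T ^ 3) := by rw [Real.log_pow]; norm_num
    rw [this]
    have hD1 : (0 : ℝ) < D := by exact_mod_cast hD0
    apply Real.log_le_log (by positivity)
    calc (D : ℝ) * (1 + T) ≤ T * (T + T) := by gcongr; linarith
      _ = 2 * T ^ 2 := by ring
      _ ≤ T * T ^ 2 := by gcongr
      _ = T ^ 3 := by ring
  have h4 : Real.log (s.metric N).det ≤ 3 * D * Real.log T := by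
    refine h1.trans ?_
    calc (D : ℝ) * Real.log (D * (1 + T)) ≤ D * (3 * Real.log T) := by gcongr
      _ = _ := by ring
  have h5 := mul_le_mul_of_nonneg_left h4 (sq_nonneg β)
  unfold potential
  linarith

/-- The integer coordinates of a bounded state are polynomially bounded. -/
theorem Bounded.abs_le_pow {N T t : ℝ} {w : Fin D → ℝ} {s : NewtonState D}
    (h : s.Bounded N T w t) (hT : 12 ≤ T) (hN : N = T ^ 9) (ht : t ≤ T)
    (hw : ∀ i, 0 ≤ w i ∧ w i ≤ 1) :
    (∀ i, |(s.1 i : ℝ)| ≤ T ^ 20) ∧ ∀ i j, |(s.2 i j : ℝ)| ≤ T ^ 20 := by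
  have hT0 : 0 < T := by linarith
  have hN0 : 0 < N := by rw [hN]; positivity
  constructor
  · intro i
    have h1 := sq_apply_le_quadForm_one_add h.posSemidef (gridPoint N s.1 - w) i
    have h2 : quadForm (1 + gridGram N s.2) (gridPoint N s.1 - w) ≤ T + t * (5 * T ^ 2) :=
      h.distSq_le
    have h3 : T + t * (5 * T ^ 2) ≤ (T ^ 4) ^ 2 := by
      have : t * (5 * T ^ 2) ≤ T * (5 * T ^ 2) := by gcongr
      have h4 : T ^ 4 ≤ (T ^ 4) ^ 2 := by
        rw [← pow_mul]; exact pow_le_pow_right₀ (by linarith) (by norm_num)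
      nlinarith [pow_pos hT0 3, sq_nonneg T]
    have h5 : |(gridPoint N s.1 - w) i| ≤ T ^ 4 :=
      abs_le_of_sq_le_sq (h1.trans (h2.trans h3)) (by positivity)
    have h6 : (s.1 i : ℝ) = N * ((gridPoint N s.1 - w) i + w i) := by
      simp only [gridPoint, Pi.sub_apply]
      field_simp
      ring
    have h7 : |(gridPoint N s.1 - w) i + w i| ≤ T ^ 4 + 1 := by
      refine (abs_add_le _ _).trans (add_le_add h5 ?_)
      rw [abs_of_nonneg (hw i).1]; exact (hw i).2
    rw [h6, abs_mul, abs_of_pos hN0, hN]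
    calc T ^ 9 * |(gridPoint (T ^ 9) s.1 - w) i + w i| ≤ T ^ 9 * (T ^ 4 + T ^ 4) := by
          gcongr
          rw [← hN]
          exact h7.trans (add_le_add le_rfl (one_le_pow₀ (by linarith)))
      _ = 2 * T ^ 13 := by ring
      _ ≤ T * T ^ 13 := by gcongr; linarith
      _ = T ^ 14 := by ring
      _ ≤ T ^ 20 := pow_le_pow_right₀ (by linarith) (by norm_num)
  · intro i j
    have h1 := h.gram_le i j
    have h2 : (s.2 i j : ℝ) = N ^ 2 * gridGram N s.2 i j := by
      simp only [gridGram, Matrix.of_apply]; field_simp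
    rw [h2, abs_mul, abs_of_pos (by positivity)]
    calc N ^ 2 * |gridGram N s.2 i j| ≤ N ^ 2 * T := by gcongr; linarith
      _ = T ^ 19 := by rw [hN]; ring
      _ ≤ T ^ 20 := pow_le_pow_right₀ (by linarith) (by norm_num)

/-- The states with integer coordinates bounded by `2 ^ l` can be stored in `(l + 2) (D + D²)`
bits. -/
theorem exists_encoding (D l : ℕ) :
    ∃ (enc : NewtonState D → (Fin ((l + 2) * (D + D * D)) → Bool))
      (dec : (Fin ((l + 2) * (D + D * D)) → Bool) → NewtonState D),
      ∀ s : NewtonState D, (∀ i, |s.1 i| ≤ 2 ^ l) → (∀ i j, |s.2 i j| ≤ 2 ^ l) →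
        dec (enc s) = s := by
  set k := (l + 2) * (D + D * D)
  let I : Finset ℤ := Finset.Icc (-2 ^ l) (2 ^ l)
  -- The interval has `2 ^ (l + 1) + 1` elements.
  have hI : Fintype.card I ≤ 2 ^ (l + 2) := by
    rw [Fintype.card_coe, Int.card_Icc]
    have h1 : (1 : ℤ) ≤ 2 ^ l := one_le_pow₀ (by norm_num)
    zify
    rw [Int.toNat_of_nonneg (by linarith), pow_add]
    linarith
  have hcard : Fintype.card ((Fin D → I) × (Fin D → Fin D → I)) ≤ Fintype.card (Fin k → Bool) := by
    simp only [Fintype.card_prod, Fintype.card_pi, Finset.prod_const, Finset.card_univ,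
      Fintype.card_fin, Fintype.card_bool]
    rw [← pow_mul, ← pow_add, show k = (l + 2) * (D + D * D) from rfl, pow_mul]
    exact Nat.pow_le_pow_left hI _
  obtain ⟨φ⟩ := Function.Embedding.nonempty_of_card_le hcard
  let val : ((Fin D → I) × (Fin D → Fin D → I)) → NewtonState D := fun p =>
    (fun i => p.1 i, Matrix.of fun i j => p.2 i j)
  have hinj : Function.Injective val := by
    intro p p' hpp
    have h1 := congrArg Prod.fst hpp
    have h2 := congrArg Prod.snd hpp
    refine Prod.ext ?_ ?_
    · ext i; exact congrFun h1 i
    · ext i j; exact congrFun (congrFun h2 i) j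
  have : Nonempty ((Fin D → I) × (Fin D → Fin D → I)) :=
    ⟨(fun _ => ⟨0, by simp [I]⟩, fun _ _ => ⟨0, by simp [I]⟩)⟩
  refine ⟨fun s => φ (Function.invFun val s), fun b => val (Function.invFun φ b), ?_⟩
  intro s h1 h2
  have hs : s = val (fun i => ⟨s.1 i, Finset.mem_Icc.2 (abs_le.1 (h1 i))⟩,
      fun i j => ⟨s.2 i j, Finset.mem_Icc.2 (abs_le.1 (h2 i j))⟩) := rfl
  rw [hs]
  simp only [Function.leftInverse_invFun hinj _, Function.leftInverse_invFun φ.injective _]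

end NewtonState

end NewtonState

/-! ### The exponential moment of one round -/

/-- Here `P` is the probability of bit `1`. The `3 / 2` is `1` from the potential increment plus the
`1 / 2` with which squared errors are counted. With `μ = c ^ 2 / (8 * D ^ 2)` and `exp s ≤ 1 + s + s
^ 2` for `|s| ≤ 1`, the linear term contributes at most `-2 * μ * e ^ 2` and the square at most `μ *
e ^ 2 / 2`, which cancels `3 / 2` exactly. -/
theorem two_point_exp_le_one {D c P h e : ℝ} (hD : 1 ≤ D) (hc0 : 0 < c) (hc1 : c ≤ 1)
    (hP0 : 0 ≤ P) (hP1 : P ≤ 1) (hh0 : 0 ≤ h) (hh1 : h ≤ 1) (he : |e| ≤ D)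
    (hdrift : e * (P - h) ≤ -(c / D * e ^ 2)) :
    P * Real.exp (c ^ 2 / (8 * D ^ 2) * (3 / 2 * e ^ 2 + 2 * e * (D / c * (1 - h))))
      + (1 - P) * Real.exp (c ^ 2 / (8 * D ^ 2) * (3 / 2 * e ^ 2 + 2 * e * (D / c * (0 - h))))
      ≤ 1 := by
  have hD0 : 0 < D := by linarith
  set μ : ℝ := c ^ 2 / (8 * D ^ 2) with hμ
  have hμ0 : 0 ≤ μ := by positivity
  set g : ℝ := c / (4 * D) * e with hg
  have hg1 : |g| ≤ 1 := by
    rw [hg, abs_mul, abs_of_pos (by positivity)]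
    calc c / (4 * D) * |e| ≤ c / (4 * D) * D := by gcongr
      _ = c / 4 := by field_simp
      _ ≤ 1 := by linarith
  have hg2 : g ^ 2 = μ * e ^ 2 / 2 := by rw [hg, hμ]; field_simp; norm_num; ring
  have hsplit : ∀ ξ : ℝ, Real.exp (μ * (3 / 2 * e ^ 2 + 2 * e * (D / c * ξ)))
      = Real.exp (3 / 2 * (μ * e ^ 2)) * Real.exp (g * ξ) := by
    intro ξ
    rw [← Real.exp_add, hg, hμ]
    congr 1
    field_simp
    ring
  have hexp : ∀ ξ : ℝ, |ξ| ≤ 1 → Real.exp (g * ξ) ≤ 1 + g * ξ + g ^ 2 := by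
    intro ξ hξ
    have h1 : |g * ξ| ≤ 1 := by
      rw [abs_mul]; exact mul_le_one₀ hg1 (abs_nonneg _) hξ
    have h2 := (abs_le.1 (Real.abs_exp_sub_one_sub_id_le h1)).2
    have h3 : (g * ξ) ^ 2 ≤ g ^ 2 := by
      rw [mul_pow]
      exact mul_le_of_le_one_right (sq_nonneg _) ((sq_le_one_iff_abs_le_one _).2 hξ)
    linarith
  have h1 := hexp (1 - h) (by rw [abs_le]; constructor <;> linarith)
  have h0 := hexp (0 - h) (by rw [abs_le]; constructor <;> linarith)
  have hmean : g * (P - h) ≤ -(2 * (μ * e ^ 2)) := by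
    have h3 : g * (P - h) = c / (4 * D) * (e * (P - h)) := by rw [hg]; ring
    rw [h3]
    calc c / (4 * D) * (e * (P - h)) ≤ c / (4 * D) * (-(c / D * e ^ 2)) := by gcongr
      _ = -(2 * (μ * e ^ 2)) := by rw [hμ]; field_simp; ring
  have hsum : P * Real.exp (g * (1 - h)) + (1 - P) * Real.exp (g * (0 - h))
      ≤ Real.exp (-(3 / 2 * (μ * e ^ 2))) := by
    have h4 := mul_le_mul_of_nonneg_left h1 hP0
    have h5 := mul_le_mul_of_nonneg_left h0 (sub_nonneg.2 hP1)
    have h6 := Real.add_one_le_exp (-(3 / 2 * (μ * e ^ 2)))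
    nlinarith
  rw [hsplit, hsplit]
  calc _ = Real.exp (3 / 2 * (μ * e ^ 2))
        * (P * Real.exp (g * (1 - h)) + (1 - P) * Real.exp (g * (0 - h))) := by ring
    _ ≤ Real.exp (3 / 2 * (μ * e ^ 2)) * Real.exp (-(3 / 2 * (μ * e ^ 2))) := by gcongr
    _ = 1 := by rw [← Real.exp_add]; simp

theorem lintegral_le_of_two_values {ν : Measure ℝ} [IsProbabilityMeasure ν] {E : Set ℝ}
    (hE : MeasurableSet E) {φ : ℝ → ENNReal} {a b R : ℝ} (ha : 0 ≤ a) (hb : 0 ≤ b)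
    (hφa : ∀ η ∈ E, φ η ≤ ENNReal.ofReal a) (hφb : ∀ η ∈ Eᶜ, φ η ≤ ENNReal.ofReal b)
    (hR : ν.real E * a + (1 - ν.real E) * b ≤ R) : ∫⁻ η, φ η ∂ν ≤ ENNReal.ofReal R := by
  rw [← lintegral_add_compl φ hE]
  calc ∫⁻ η in E, φ η ∂ν + ∫⁻ η in Eᶜ, φ η ∂ν
      ≤ ∫⁻ _ in E, ENNReal.ofReal a ∂ν + ∫⁻ _ in Eᶜ, ENNReal.ofReal b ∂ν :=
        add_le_add (setLIntegral_mono' hE hφa) (setLIntegral_mono' hE.compl hφb)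
    _ = ENNReal.ofReal (ν.real E * a + (1 - ν.real E) * b) := by
        rw [setLIntegral_const, setLIntegral_const, ← probReal_compl_eq_one_sub hE,
          ENNReal.ofReal_add (by positivity) (by positivity),
          ENNReal.ofReal_mul (by positivity), ENNReal.ofReal_mul (by positivity),
          ofReal_measureReal, ofReal_measureReal, mul_comm, mul_comm (ENNReal.ofReal b)]
    _ ≤ ENNReal.ofReal R := ENNReal.ofReal_le_ofReal hR

theorem inner_eq_dotProduct_ofLp {D : ℕ} (w q : Vec D) : inner ℝ w q = w.ofLp ⬝ᵥ q.ofLp := by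
  rw [EuclideanSpace.inner_eq_star_dotProduct, star_trivial, dotProduct_comm]

/-! ### The learner and the tail of its squared error -/

section Learner

variable {D k : ℕ}

/-- The quantized Newton method as a learner with `k` bits of memory; `h` is the probability that
the noise exceeds `m`. -/
noncomputable def newtonLearner (N β h m : ℝ) (enc : NewtonState D → Fin k → Bool)
    (dec : (Fin k → Bool) → NewtonState D) : OnlineLearner D k where
  init := enc 0
  answer s q := (dec s).answer N (gridFloor N q.ofLp)
  threshold s q := (dec s).answer N (gridFloor N q.ofLp) + D * m
  update s q b := enc ((dec s).newton N (gridFloor N q.ofLp) (β * ((if b then 1 else 0) - h)))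
  measurable_answer s := by
    have h1 : Measurable fun q : Vec D => gridFloor N q.ofLp := by
      unfold gridFloor; fun_prop
    exact (Measurable.of_discrete (f := fun n => (dec s).answer N n)).comp h1
  measurable_threshold s := by
    have h1 : Measurable fun q : Vec D => gridFloor N q.ofLp := by
      unfold gridFloor; fun_prop
    exact (Measurable.of_discrete (f := fun n => (dec s).answer N n + D * m)).comp h1
  measurable_update s b := by
    have h1 : Measurable fun q : Vec D => gridFloor N q.ofLp := by
      unfold gridFloor; fun_prop
    exact (Measurable.of_discrete (f := fun n => enc ((dec s).newton N n
      (β * ((if b then 1 else 0) - h))))).comp h1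

/-- One Newton step changes the potential by the true squared error, a term that is linear in the
feedback, and a small error. -/
theorem NewtonState.Bounded.newton_gridFloor {N T β t ξ : ℝ} {w q : Fin D → ℝ}
    {s : NewtonState D} (hs : s.Bounded N T w t) (hT : 12 ≤ T) (hDT : (D : ℝ) ≤ T)
    (hN : N = T ^ 9) (hβ0 : 0 ≤ β) (hβ : β ≤ T) (ht0 : 0 ≤ t) (ht : t + 1 ≤ T)
    (hw : ∀ i, 0 ≤ w i ∧ w i ≤ 1) (hq : ∀ i, 0 ≤ q i ∧ q i ≤ 1) (hξ : |ξ| ≤ 1) :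
    (s.newton N (gridFloor N q) (β * ξ)).Bounded N T w (t + 1) ∧
      (s.newton N (gridFloor N q) (β * ξ)).potential N β w ≤ s.potential N β w
        + (s.answer N (gridFloor N q) - w ⬝ᵥ q) ^ 2
        + 2 * (s.answer N (gridFloor N q) - w ⬝ᵥ q) * (β * ξ) + 1 / T := by
  have hT0 : 0 < T := by linarith
  have hN0 : 0 < N := by rw [hN]; positivity
  have hqh : ∀ i, 0 ≤ gridPoint N (gridFloor N q) i ∧ gridPoint N (gridFloor N q) i ≤ 1 :=
    fun i => gridPoint_gridFloor_mem_unit hN0 (hq i)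
  obtain ⟨h1, h2⟩ := hs.newton hT hDT hN hβ0 hβ ht0 ht hw hqh hξ
  refine ⟨h1, h2.trans ?_⟩
  have hω := dotProduct_mem_of_unit hw hq
  set z := s.answer N (gridFloor N q) with hz
  have hz0 : 0 ≤ z := le_max_left _ _
  have hzD : z ≤ D := max_le (by positivity) (min_le_left _ _)
  -- Rounding the query shifts the true value by `δ ≤ T ^ (-8)`; this changes the increment by at
  -- most `5 * T * δ`, a second `1 / (2 * T)`.
  set δ := w ⬝ᵥ q - w ⬝ᵥ gridPoint N (gridFloor N q) with hδ
  have hδeq : δ = ∑ i, w i * (q i - gridPoint N (gridFloor N q) i) := by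
    simp only [hδ, dotProduct, mul_sub, Finset.sum_sub_distrib]
  have hδ0 : 0 ≤ δ := by
    rw [hδeq]
    exact Finset.sum_nonneg fun i _ => mul_nonneg (hw i).1 (gridPoint_gridFloor_mem hN0 q i).1
  have hδ1 : δ ≤ T / N := by
    rw [hδeq]
    calc ∑ i, w i * (q i - gridPoint N (gridFloor N q) i) ≤ ∑ _i : Fin D, 1 / N :=
          Finset.sum_le_sum fun i _ => by
            have h3 := gridPoint_gridFloor_mem hN0 q i
            calc _ ≤ 1 * (1 / N) := mul_le_mul (hw i).2 h3.2 h3.1 zero_le_one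
              _ = _ := one_mul _
      _ = D / N := by simp [div_eq_mul_inv]
      _ ≤ T / N := by gcongr
  have hδ2 : δ ≤ 1 / T ^ 8 := hδ1.trans (le_of_eq (by rw [hN]; field_simp))
  have hδT : δ * (5 * T) ≤ 1 / (2 * T) := by
    calc δ * (5 * T) ≤ 1 / T ^ 8 * (5 * T) := by gcongr
      _ = 5 / T ^ 7 := by field_simp
      _ ≤ 1 / (2 * T) := by
        rw [div_le_div_iff₀ (by positivity) (by positivity)]
        have : T ^ 2 ≤ T ^ 7 := pow_le_pow_right₀ (by linarith) (by norm_num)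
        nlinarith
  have hδle1 : δ ≤ 1 := hδ2.trans (by
    rw [div_le_one (by positivity)]; exact one_le_pow₀ (by linarith))
  have hs' : z - w ⬝ᵥ gridPoint N (gridFloor N q) = (z - w ⬝ᵥ q) + δ := by rw [hδ]; ring
  have hβξ : β * ξ ≤ T :=
    (mul_le_of_le_one_right hβ0 ((le_abs_self _).trans hξ)).trans hβ
  have h4 : δ * (2 * (z - w ⬝ᵥ q) + δ + 2 * (β * ξ)) ≤ δ * (5 * T) := by
    gcongr
    linarith [hω.1]
  have h5 : 1 / T = 1 / (2 * T) + 1 / (2 * T) := by field_simp; norm_num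
  rw [hs', h5]
  nlinarith

/-- The exponential of the potential plus half the squared errors is a supermartingale. -/
theorem newtonLearner_lintegral_step_le {N T β c h m t : ℝ} {enc : NewtonState D → Fin k → Bool}
    {dec : (Fin k → Bool) → NewtonState D}
    (henc : ∀ s : NewtonState D, (∀ i, |(s.1 i : ℝ)| ≤ T ^ 20) → (∀ i j, |(s.2 i j : ℝ)| ≤ T ^ 20) →
      dec (enc s) = s)
    (ν : Measure ℝ) [IsProbabilityMeasure ν] (hc0 : 0 < c) (hc1 : c ≤ 1)
    (hh : h = ν.real (Set.Ioi m))
    (hdecay : ∀ x, |x| ≤ 1 → x * (ν.real (Set.Ioi (m + x)) - ν.real (Set.Ioi m)) ≤ -(c * x ^ 2))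
    (hD : 0 < D) (hT : 12 ≤ T) (hDT : (D : ℝ) ≤ T) (hN : N = T ^ 9) (hβ : β = D / c) (hβT : β ≤ T)
    (ht0 : 0 ≤ t) (ht : t + 1 ≤ T) {w : Vec D} (hw : InUnitCube w) (𝒟 : Measure (Vec D))
    [IsProbabilityMeasure 𝒟] (h𝒟 : ∀ᵐ q ∂𝒟, InUnitCube q) (L : ℝ) (s : Fin k → Bool)
    (hs : (dec s).Bounded N T w.ofLp t) :
    ∫⁻ x, ENNReal.ofReal (Real.exp (c ^ 2 / (8 * D ^ 2) *
          (((newtonLearner N β h m enc dec).answer s x.1 - inner ℝ w x.1) ^ 2 / 2 - 1 / T)))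
        * ENNReal.ofReal (Real.exp (c ^ 2 / (8 * D ^ 2) *
          ((dec ((newtonLearner N β h m enc dec).step w s x)).potential N β w.ofLp + L)))
        ∂(𝒟.prod ν)
      ≤ ENNReal.ofReal (Real.exp (c ^ 2 / (8 * D ^ 2) * ((dec s).potential N β w.ofLp + L))) := by
  refine (lintegral_prod_le _).trans ?_
  set A := newtonLearner N β h m enc dec with hA
  set V := (dec s).potential N β w.ofLp with hV
  set μ : ℝ := c ^ 2 / (8 * D ^ 2) with hμ
  have hD0 : (0 : ℝ) < D := by exact_mod_cast hD
  have hμ0 : 0 ≤ μ := by positivity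
  have hh0 : 0 ≤ h := by rw [hh]; positivity
  have hh1 : h ≤ 1 := by rw [hh]; exact measureReal_le_one
  refine (lintegral_mono_ae (g := fun _ => ENNReal.ofReal (Real.exp (μ * (V + L)))) ?_).trans
    (by simp)
  filter_upwards [h𝒟] with q hq
  have hω : 0 ≤ inner ℝ w q ∧ inner ℝ w q ≤ (D : ℝ) := by
    rw [inner_eq_dotProduct_ofLp]; exact dotProduct_mem_of_unit hw hq
  set n := gridFloor N q.ofLp with hn
  set z := (dec s).answer N n with hz
  have hz0 : 0 ≤ z := le_max_left _ _
  have hzD : z ≤ D := max_le (by positivity) (min_le_left _ _)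
  have hzA : A.answer s q = z := rfl
  set e := z - inner ℝ w q with he
  have heD : |e| ≤ D := by rw [abs_le]; constructor <;> linarith [hω.1, hω.2]
  have hbit : ∀ ξ : ℝ, |ξ| ≤ 1 →
      ENNReal.ofReal (Real.exp (μ * (e ^ 2 / 2 - 1 / T))) * ENNReal.ofReal (Real.exp (μ *
        ((dec (enc ((dec s).newton N n (β * ξ)))).potential N β w.ofLp + L)))
      ≤ ENNReal.ofReal (Real.exp (μ * (V + L)) *
          Real.exp (μ * (3 / 2 * e ^ 2 + 2 * e * (D / c * ξ)))) := by
    intro ξ hξ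
    obtain ⟨h1, h2⟩ := hs.newton_gridFloor (ξ := ξ) hT hDT hN
      (by rw [hβ]; positivity) hβT ht0 ht hw hq hξ
    have h3 := h1.abs_le_pow hT hN ht hw
    rw [henc _ h3.1 h3.2, ← ENNReal.ofReal_mul (Real.exp_nonneg _), ← Real.exp_add,
      ← Real.exp_add, ← mul_add, ← mul_add]
    refine ENNReal.ofReal_le_ofReal
      (Real.exp_le_exp.2 (mul_le_mul_of_nonneg_left ?_ hμ0))
    rw [← inner_eq_dotProduct_ofLp] at h2
    rw [← hβ]
    linarith
  -- Because of the threshold `z + D * m`, the bit compares the normalized noise with `m + e / D`,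
  -- so its probability is the tail near `m`.
  set E : Set ℝ := Set.Ioi (m + e / D) with hE
  have horacle : ∀ η : ℝ, (η ∈ E ↔ A.threshold s q < inner ℝ w q + D * η) := by
    intro η
    change m + e / D < η ↔ z + D * m < _
    rw [← mul_lt_mul_iff_right₀ hD0, mul_add, mul_div_cancel₀ _ hD0.ne', he]
    constructor <;> intro h <;> linarith
  have hstep1 : ∀ η ∈ E, A.step w s (q, η) = enc ((dec s).newton N n (β * (1 - h))) := by
    intro η hη
    have : binaryOracle (inner ℝ w q + D * η) (A.threshold s q) = true := by
      simpa [binaryOracle] using (horacle η).1 hη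
    simp only [OnlineLearner.step, this]
    simp [hA, newtonLearner, hn]
  have hstep0 : ∀ η ∈ Eᶜ, A.step w s (q, η) = enc ((dec s).newton N n (β * (0 - h))) := by
    intro η hη
    have : binaryOracle (inner ℝ w q + D * η) (A.threshold s q) = false := by
      have := fun h' => hη ((horacle η).2 h')
      simpa [binaryOracle] using this
    simp only [OnlineLearner.step, this]
    simp [hA, newtonLearner, hn]
  refine lintegral_le_of_two_values (E := E) measurableSet_Ioi
    (a := Real.exp (μ * (V + L)) * Real.exp (μ * (3 / 2 * e ^ 2 + 2 * e * (D / c * (1 - h)))))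
    (b := Real.exp (μ * (V + L)) * Real.exp (μ * (3 / 2 * e ^ 2 + 2 * e * (D / c * (0 - h)))))
    (by positivity) (by positivity) ?_ ?_ ?_
  · intro η hη
    simp only [hstep1 η hη, hzA, ← he]
    exact hbit _ (by rw [abs_le]; constructor <;> linarith)
  · intro η hη
    simp only [hstep0 η hη, hzA, ← he]
    exact hbit _ (by rw [abs_le]; constructor <;> linarith)
  · have hdr : e * (ν.real E - h) ≤ -(c / D * e ^ 2) := by
      have h1 := hdecay (e / D) (by
        rw [abs_div, abs_of_pos hD0, div_le_one hD0]; exact heD)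
      rw [← hh, ← hE] at h1
      have h2 := mul_le_mul_of_nonneg_left h1 hD0.le
      have h3 : (D : ℝ) * (e / D * (ν.real E - h)) = e * (ν.real E - h) := by field_simp
      have h4 : (D : ℝ) * -(c * (e / D) ^ 2) = -(c / D * e ^ 2) := by field_simp
      linarith
    have h1 := two_point_exp_le_one (by exact_mod_cast hD) hc0 hc1 measureReal_nonneg
      measureReal_le_one hh0 hh1 heD hdr
    rw [← hμ] at h1
    have h2 := mul_le_mul_of_nonneg_left h1 (Real.exp_nonneg (μ * (V + L)))
    linarith

/-- The total squared error of the quantized Newton method is logarithmic with high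
probability. -/
theorem newtonLearner_sum_sq_error_tail {T : ℕ} {N β c h m : ℝ}
    {enc : NewtonState D → Fin k → Bool} {dec : (Fin k → Bool) → NewtonState D}
    (henc : ∀ s : NewtonState D, (∀ i, |(s.1 i : ℝ)| ≤ (T : ℝ) ^ 20) →
      (∀ i j, |(s.2 i j : ℝ)| ≤ (T : ℝ) ^ 20) → dec (enc s) = s)
    (ν : Measure ℝ) [IsProbabilityMeasure ν] (hc0 : 0 < c) (hc1 : c ≤ 1)
    (hh : h = ν.real (Set.Ioi m))
    (hdecay : ∀ x, |x| ≤ 1 → x * (ν.real (Set.Ioi (m + x)) - ν.real (Set.Ioi m)) ≤ -(c * x ^ 2))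
    (hD : 0 < D) (hT : 12 ≤ (T : ℝ)) (hDT : (D : ℝ) ≤ T) (hN : N = (T : ℝ) ^ 9) (hβ : β = D / c)
    (hβT : β ≤ T) {w : Vec D} (hw : InUnitCube w) (𝒟 : Measure (Vec D))
    [IsProbabilityMeasure 𝒟] (h𝒟 : ∀ᵐ q ∂𝒟, InUnitCube q) :
    streamLaw T 𝒟 ν {x | 2 * (1 + D + β ^ 2 * (3 * D * Real.log T)
        + 8 * D ^ 2 / c ^ 2 * (3 * Real.log T)) ≤
      ∑ t : Fin T, ((newtonLearner N β h m enc dec).answer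
        ((newtonLearner N β h m enc dec).memoryAfter w x t) (x t).1 - inner ℝ w (x t).1) ^ 2}
      ≤ ENNReal.ofReal (1 / (T : ℝ) ^ 3) := by
  set A := newtonLearner N β h m enc dec with hA
  set μ : ℝ := c ^ 2 / (8 * D ^ 2) with hμ
  set L : ℝ := β ^ 2 * (3 * D * Real.log T) with hL
  have hD0 : (0 : ℝ) < D := by exact_mod_cast hD
  have hT0 : (0 : ℝ) < T := by linarith
  have hμ0 : 0 < μ := by positivity
  have hβ0 : 0 ≤ β := by rw [hβ]; positivity
  have hinit : dec A.init = 0 := by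
    have h0 := (NewtonState.bounded_zero (N := N) hw hDT).abs_le_pow hT hN hT0.le hw
    exact henc 0 h0.1 h0.2
  set f : (Fin k → Bool) → Vec D × ℝ → ENNReal := fun s x =>
    ENNReal.ofReal (Real.exp (μ * ((A.answer s x.1 - inner ℝ w x.1) ^ 2 / 2 - 1 / T))) with hf
  set G : (Fin k → Bool) → ENNReal := fun s =>
    ENNReal.ofReal (Real.exp (μ * ((dec s).potential N β w.ofLp + L))) with hG
  have hmain := A.lintegral_prod_memoryAfter_le w (𝒟.prod ν) G f
    (fun _ _ => ENNReal.ofReal_ne_top) T (fun t s => (dec s).Bounded N T w.ofLp t)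
    (by rw [hinit]; simpa using NewtonState.bounded_zero (N := N) hw hDT)
    (by
      intro t ht s hs
      have h1 : ∀ᵐ x ∂(𝒟.prod ν), InUnitCube x.1 := Measure.quasiMeasurePreserving_fst.ae h𝒟
      filter_upwards [h1] with x hx
      have ht1 : (t : ℝ) + 1 ≤ T := by exact_mod_cast ht
      set b := binaryOracle (inner ℝ w x.1 + (D : ℝ) * x.2) (A.threshold s x.1) with hb
      have hh0 : 0 ≤ h := by rw [hh]; positivity
      have hh1 : h ≤ 1 := by rw [hh]; exact measureReal_le_one
      have h2 := (hs.newton_gridFloor (ξ := (if b then 1 else 0) - h) hT hDT hN hβ0 hβT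
        (by positivity) ht1 hw hx (by split_ifs <;> rw [abs_le] <;> constructor <;> linarith)).1
      have h3 := h2.abs_le_pow hT hN ht1 hw
      have h4 : dec (A.step w s x)
          = (dec s).newton N (gridFloor N x.1.ofLp) (β * ((if b then 1 else 0) - h)) :=
        henc _ h3.1 h3.2
      rw [h4]
      push_cast
      exact h2)
    (by
      intro t ht s hs
      exact newtonLearner_lintegral_step_le henc ν hc0 hc1 hh hdecay hD hT hDT hN hβ hβT
        (by positivity) (by exact_mod_cast ht) hw 𝒟 h𝒟 L s hs)
    (by
      intro s hs
      rw [hG, ENNReal.one_le_ofReal]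
      apply Real.one_le_exp
      have := hs.neg_potential_le (β := β) (by linarith) hD hDT le_rfl
      exact mul_nonneg hμ0.le (by linarith))
  have hGinit : G A.init ≤ ENNReal.ofReal (Real.exp (μ * (D + L))) := by
    rw [hG]
    apply ENNReal.ofReal_le_ofReal
    gcongr
    rw [hinit]
    exact NewtonState.potential_zero_le hw
  have hmeas : Measurable fun x : Fin T → Vec D × ℝ =>
      ∏ t : Fin T, f (A.memoryAfter w x t) (x t) := by
    refine A.measurable_prod_memoryAfter w fun s => ?_
    have h1 : Measurable fun x : Vec D × ℝ => A.answer s x.1 :=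
      (A.measurable_answer s).comp measurable_fst
    simp only [hf]
    fun_prop
  have hprod : ∀ x : Fin T → Vec D × ℝ, ∏ t : Fin T, f (A.memoryAfter w x t) (x t)
      = ENNReal.ofReal (Real.exp (μ * ((∑ t : Fin T,
          (A.answer (A.memoryAfter w x t) (x t).1 - inner ℝ w (x t).1) ^ 2) / 2 - 1))) := by
    intro x
    have hone : ∑ _t : Fin T, 1 / (T : ℝ) = 1 := by
      rw [Finset.sum_const, Finset.card_univ, Fintype.card_fin, nsmul_eq_mul]
      field_simp
    simp only [hf]
    rw [← ENNReal.ofReal_prod_of_nonneg fun _ _ => Real.exp_nonneg _, ← Real.exp_sum,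
      ← Finset.mul_sum, Finset.sum_sub_distrib, ← Finset.sum_div, hone]
  -- The initial value is at most `exp (μ * (D + L))`, so Markov at level `exp Θ` leaves `T ^ (-3)`.
  -- Dividing `Θ` by `μ` produces the factor `8 * D ^ 2 / c ^ 2`; the extra `1` is the total of the
  -- rounding errors.
  set Θ : ℝ := μ * (D + L) + 3 * Real.log T with hΘ
  have hmarkov := mul_meas_ge_le_lintegral₀ (μ := streamLaw T 𝒟 ν) hmeas.aemeasurable
    (ENNReal.ofReal (Real.exp Θ))
  have hsub : streamLaw T 𝒟 ν {x | 2 * (1 + D + L + 8 * D ^ 2 / c ^ 2 * (3 * Real.log T)) ≤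
      ∑ t : Fin T, (A.answer (A.memoryAfter w x t) (x t).1 - inner ℝ w (x t).1) ^ 2}
      ≤ streamLaw T 𝒟 ν {x | ENNReal.ofReal (Real.exp Θ)
        ≤ ∏ t : Fin T, f (A.memoryAfter w x t) (x t)} := by
    refine measure_mono fun x hx => ?_
    rw [Set.mem_ofPred_eq] at hx ⊢
    rw [hprod]
    apply ENNReal.ofReal_le_ofReal
    gcongr
    have h1 : Θ = μ * (D + L + 8 * D ^ 2 / c ^ 2 * (3 * Real.log T)) := by
      rw [hΘ, hμ]; field_simp
    rw [h1]
    gcongr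
    linarith
  refine hsub.trans ?_
  have hpos : ENNReal.ofReal (Real.exp Θ) ≠ 0 := by
    simpa using Real.exp_pos Θ
  have h2 : ENNReal.ofReal (Real.exp Θ) * streamLaw T 𝒟 ν {x | ENNReal.ofReal (Real.exp Θ)
        ≤ ∏ t : Fin T, f (A.memoryAfter w x t) (x t)}
      ≤ ENNReal.ofReal (Real.exp Θ) * ENNReal.ofReal (1 / (T : ℝ) ^ 3) := by
    refine hmarkov.trans (hmain.trans (hGinit.trans (le_of_eq ?_)))
    rw [← ENNReal.ofReal_mul (Real.exp_nonneg _)]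
    congr 1
    have h3 : Real.exp (3 * Real.log T) = (T : ℝ) ^ 3 := by
      rw [mul_comm, Real.exp_mul, Real.exp_log hT0]; norm_cast
    rw [hΘ, Real.exp_add, h3]
    field_simp
  exact (ENNReal.mul_le_mul_iff_right hpos ENNReal.ofReal_ne_top).1 h2

end Learner

/-! ### From squared errors to the stated bounds -/

theorem minCapProb_le_one {D d : ℕ} (hd : 1 ≤ d) {U : Submodule ℝ (Vec D)} (𝒟 : Measure (Vec D))
    [IsProbabilityMeasure 𝒟] (B : OrthonormalBasis (Fin d) ℝ U) (θ : ℝ) :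
    minCapProb 𝒟 B θ ≤ 1 := by
  have hmeas : Measurable fun q : Vec D => (‖q‖⁻¹ : ℝ) • q := by fun_prop
  have : IsProbabilityMeasure (normalizedLaw 𝒟) :=
    Measure.isProbabilityMeasure_map hmeas.aemeasurable
  refine (ciInf_le (Set.finite_range _).bddBelow ⟨0, hd⟩).trans ?_
  exact measureReal_le_one

theorem ae_streamLaw_inUnitCube {D : ℕ} (T : ℕ) (𝒟 : Measure (Vec D)) [IsProbabilityMeasure 𝒟]
    (ν : Measure ℝ) [IsProbabilityMeasure ν] (h : ∀ᵐ q ∂𝒟, InUnitCube q) :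
    ∀ᵐ x ∂(streamLaw T 𝒟 ν), ∀ t, InUnitCube (x t).1 := by
  rw [ae_all_iff]
  intro t
  have h1 : ∀ᵐ x ∂(𝒟.prod ν), InUnitCube x.1 := Measure.quasiMeasurePreserving_fst.ae h
  exact (measurePreserving_eval (fun _ : Fin T => 𝒟.prod ν) t).quasiMeasurePreserving.ae h1

/-- The learner without memory that always answers `0`. -/
noncomputable def zeroLearner (D : ℕ) : OnlineLearner D 0 where
  init := fun _ => false
  answer _ _ := 0
  threshold _ _ := 0
  update s _ _ := s
  measurable_answer _ := measurable_const
  measurable_threshold _ := measurable_const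
  measurable_update _ _ := measurable_const

theorem zeroLearner_averageError_le {D T : ℕ} {w : Vec D} (hw : InUnitCube w)
    {x : Fin T → Vec D × ℝ} (hx : ∀ t, InUnitCube (x t).1) :
    (zeroLearner D).averageError w x ≤ D := by
  unfold OnlineLearner.averageError
  have h1 : ∀ t : Fin T, |(zeroLearner D).answer ((zeroLearner D).memoryAfter w x t) (x t).1
      - inner ℝ w (x t).1| ≤ D := by
    intro t
    change |0 - inner ℝ w (x t).1| ≤ (D : ℝ)
    have h := dotProduct_mem_of_unit hw (hx t)
    rw [← inner_eq_dotProduct_ofLp] at h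
    rw [zero_sub, abs_neg, abs_of_nonneg h.1]
    exact h.2
  calc _ ≤ 1 / (T : ℝ) * ∑ _t : Fin T, (D : ℝ) := by
        gcongr with t
        exact h1 t
    _ = T / T * D := by simp; ring
    _ ≤ 1 * D := by gcongr; exact div_self_le_one _
    _ = D := one_mul _

/-- Cauchy–Schwarz over the `T` rounds. -/
theorem averageError_le_of_sum_sq_le {D k T : ℕ} (A : OnlineLearner D k) (w : Vec D)
    (x : Fin T → Vec D × ℝ) {b : ℝ} (hb : 0 ≤ b)
    (h : ∑ t : Fin T, (A.answer (A.memoryAfter w x t) (x t).1 - inner ℝ w (x t).1) ^ 2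
      ≤ T * b ^ 2) : A.averageError w x ≤ b := by
  unfold OnlineLearner.averageError
  rcases Nat.eq_zero_or_pos T with rfl | hT
  · simpa using hb
  have hT0 : (0 : ℝ) < T := by exact_mod_cast hT
  have h1 := sq_sum_le_card_mul_sum_sq (s := Finset.univ) (f := fun t : Fin T =>
    |A.answer (A.memoryAfter w x t) (x t).1 - inner ℝ w (x t).1|)
  simp only [sq_abs, Finset.card_univ, Fintype.card_fin] at h1
  have h2 : (∑ t : Fin T, |A.answer (A.memoryAfter w x t) (x t).1 - inner ℝ w (x t).1|) ^ 2
      ≤ (T * b) ^ 2 := by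
    refine h1.trans ?_
    calc _ ≤ (T : ℝ) * (T * b ^ 2) := by gcongr
      _ = _ := by ring
  have h3 := abs_le_of_sq_le_sq' h2 (by positivity)
  rw [one_div, inv_mul_le_iff₀ hT0]
  exact h3.2

theorem rpow_seven_halves {x : ℝ} (hx : 0 ≤ x) : x ^ (7 / 2 : ℝ) = x ^ 3 * √x := by
  rcases hx.eq_or_lt with rfl | h
  · simp
  · rw [show (7 / 2 : ℝ) = (3 : ℕ) + 1 / 2 by norm_num, Real.rpow_add h, Real.rpow_natCast,
      Real.sqrt_eq_rpow]

/-- The arithmetic-geometric mean step that turns the bound on the squared errors into the bound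
on the average error. -/
theorem sum_sq_bound_le {D T c a ℓ : ℝ} (hD : 2 ≤ D) (hT : 1 ≤ T) (hc0 : 0 < c) (hc1 : c ≤ 1)
    (hℓ : 1 ≤ ℓ) (ha : 2 * (D ^ 3 * √D) ≤ a) :
    2 * (1 + D + (D / c) ^ 2 * (3 * D * ℓ) + 8 * D ^ 2 / c ^ 2 * (3 * ℓ))
      ≤ T * (10 / c * (1 / √T * (a + √D * ℓ))) ^ 2 := by
  have hT0 : 0 < T := by linarith
  have hsq : √T ^ 2 = T := Real.sq_sqrt hT0.le
  have hsD : √D ^ 2 = D := Real.sq_sqrt (by linarith)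
  have hrhs : T * (10 / c * (1 / √T * (a + √D * ℓ))) ^ 2 = 100 * (a + √D * ℓ) ^ 2 / c ^ 2 := by
    have : 0 < √T := Real.sqrt_pos.2 hT0
    field_simp
    rw [hsq]
    ring
  have hlhs : 2 * (1 + D + (D / c) ^ 2 * (3 * D * ℓ) + 8 * D ^ 2 / c ^ 2 * (3 * ℓ))
      = (2 * ((1 + D) * c ^ 2 + 3 * D ^ 3 * ℓ + 24 * D ^ 2 * ℓ)) / c ^ 2 := by
    field_simp
    ring
  rw [hrhs, hlhs, div_le_div_iff_of_pos_right (by positivity)]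
  have h1 : (1 + D) * c ^ 2 ≤ (1 + D) * 1 := by
    gcongr; exact pow_le_one₀ hc0.le hc1
  have h2 : D ^ 2 * 1 ≤ D ^ 2 * ℓ := by gcongr
  have h3 : D ^ 2 * ℓ * 2 ≤ D ^ 2 * ℓ * D := by gcongr
  -- Since `(a + s) ^ 2 ≥ 4 * a * s` with `s = √D * ℓ`, and `a * s ≥ 2 * D ^ 4 * ℓ`, the right side
  -- dominates every term on the left.
  have h4 : 2 * (D ^ 3 * √D) * (√D * ℓ) ≤ a * (√D * ℓ) := by gcongr
  have h5 : 2 * (D ^ 3 * √D) * (√D * ℓ) = 2 * D ^ 3 * ℓ * D := by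
    calc _ = 2 * D ^ 3 * ℓ * √D ^ 2 := by ring
      _ = _ := by rw [hsD]
  have h6 : D ^ 3 * ℓ * 1 ≤ D ^ 3 * ℓ * D := by gcongr; linarith
  nlinarith [sq_nonneg (a - √D * ℓ)]

theorem theorem1 (u : ℝ) (ν : Measure ℝ) [IsProbabilityMeasure ν] (hatom : ∀ c : ℝ, ν {c} = 0)
    (hν : ∀ᵐ e ∂ν, e ∈ Set.Icc (-u) u) :
    -- the constant of the error and probability bounds depends on the noise law only
    ∃ C : ℝ, 0 < C ∧ ∀ D d : ℕ, 1 ≤ d → d < D →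
      -- the constant of the memory bound
      ∃ M : ℝ, 0 < M ∧ ∀ T : ℕ, 1 ≤ T →
        ∀ U : Submodule ℝ (Vec D), Module.finrank ℝ U = d →
          ∃ (k : ℕ) (A : OnlineLearner D k), (k : ℝ) ≤ M * Real.log T ∧
            -- the algorithm knows neither the database nor the query distribution
            ∀ w : Vec D, InUnitCube w →
            ∀ (𝒟 : Measure (Vec D)) [IsProbabilityMeasure 𝒟],
              (∀ᵐ q ∂𝒟, q ∈ U ∧ InUnitCube q ∧ q ≠ 0) →
            ∀ (B : OrthonormalBasis (Fin d) ℝ U) (p r : ℝ),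
              p = minCapProb 𝒟 B (capAngle d) → 0 < p → r = 2 / p ^ 2 →
              1 - C * (Real.log (d * D * T) / (T : ℝ) ^ 3
                    + d * Real.log (d * T) / (T : ℝ) ^ 30)
                ≤ (streamLaw T 𝒟 ν).real
                    {x | A.averageError w x ≤
                      C * ((1 / √(T : ℝ)) *
                        (r * (D : ℝ) ^ (7 / 2 : ℝ) * d + √(D : ℝ) * Real.log T))} := by
  obtain ⟨m, c, hc0, hc1, hdecay⟩ := exists_tail_linear_decay u ν hatom hν
  refine ⟨10 / c, by positivity, fun D d hd hdD => ?_⟩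
  have hD2 : (2 : ℝ) ≤ D := by exact_mod_cast (by omega : 2 ≤ D)
  have hd1 : (1 : ℝ) ≤ d := by exact_mod_cast hd
  refine ⟨62 * (D + D * D), by positivity, fun T hT U _ => ?_⟩
  have hT1 : (1 : ℝ) ≤ T := by exact_mod_cast hT
  have hT0 : (0 : ℝ) < T := by linarith
  have hlogT : 0 ≤ Real.log T := Real.log_nonneg hT1
  -- As `D ≥ 2`, the first logarithm is at least `log 2 ≥ 1 / 2`, and `10 / c ≥ 10` absorbs the
  -- factor `2`.
  have hfail : 1 / (T : ℝ) ^ 3 ≤ 10 / c * (Real.log (d * D * T) / (T : ℝ) ^ 3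
      + d * Real.log (d * T) / (T : ℝ) ^ 30) := by
    have h1 : (1 : ℝ) / 2 ≤ Real.log (d * D * T) := by
      have h2 : Real.log 2 ≤ Real.log (d * D * T) := by
        apply Real.log_le_log (by norm_num)
        calc (2 : ℝ) = 1 * 2 * 1 := by norm_num
          _ ≤ d * D * T := by gcongr
      linarith [Real.log_two_gt_d9]
    have h3 : 0 ≤ d * Real.log (d * T) / (T : ℝ) ^ 30 := by
      have : 0 ≤ Real.log (d * T) := Real.log_nonneg (one_le_mul_of_one_le_of_one_le hd1 hT1)
      positivity
    have h4 : (10 : ℝ) ≤ 10 / c := by rw [le_div_iff₀ hc0]; linarith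
    calc 1 / (T : ℝ) ^ 3 = 2 * (1 / 2 / (T : ℝ) ^ 3) := by ring
      _ ≤ 10 / c * (Real.log (d * D * T) / (T : ℝ) ^ 3) := by
        gcongr
        linarith
      _ ≤ _ := by
        gcongr
        linarith
  have hmain : ∀ {p r : ℝ}, 0 < p → p ≤ 1 → r = 2 / p ^ 2 →
      2 * ((D : ℝ) ^ 3 * √(D : ℝ)) ≤ r * (D : ℝ) ^ (7 / 2 : ℝ) * d := by
    intro p r hp0 hp1 hr
    have hr2 : 2 ≤ r := by
      rw [hr, le_div_iff₀ (by positivity)]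
      have : p ^ 2 ≤ 1 := pow_le_one₀ hp0.le hp1
      linarith
    rw [rpow_seven_halves (by positivity)]
    calc 2 * ((D : ℝ) ^ 3 * √(D : ℝ)) = 2 * ((D : ℝ) ^ 3 * √(D : ℝ)) * 1 := by ring
      _ ≤ _ := by gcongr
  -- The cutoff is where `10 / c * 2 * D ^ (7 / 2) / √T` equals the trivial error bound `D`. This
  -- case includes `T = 1`, where `log T = 0` forbids any memory.
  by_cases hsmall : (T : ℝ) ≤ 400 * D ^ 5 / c ^ 2
  · refine ⟨0, zeroLearner D, by simp only [Nat.cast_zero]; positivity, ?_⟩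
    intro w hw 𝒟 _ h𝒟 B p r hp hp0 hr
    have hle := hmain hp0 (hp ▸ minCapProb_le_one hd 𝒟 B _) hr
    have hcube : ∀ᵐ q ∂𝒟, InUnitCube q := h𝒟.mono fun q hq => hq.2.1
    have hprob : IsProbabilityMeasure (streamLaw T 𝒟 ν) := by unfold streamLaw; infer_instance
    have hone : (streamLaw T 𝒟 ν).real {x | (zeroLearner D).averageError w x ≤
        10 / c * ((1 / √(T : ℝ)) *
          (r * (D : ℝ) ^ (7 / 2 : ℝ) * d + √(D : ℝ) * Real.log T))} = 1 := by
      have hae : ∀ᵐ x ∂(streamLaw T 𝒟 ν), x ∈ {x | (zeroLearner D).averageError w x ≤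
          10 / c * ((1 / √(T : ℝ)) *
            (r * (D : ℝ) ^ (7 / 2 : ℝ) * d + √(D : ℝ) * Real.log T))} := by
        filter_upwards [ae_streamLaw_inUnitCube T 𝒟 ν hcube] with x hx
        refine (zeroLearner_averageError_le hw hx).trans ?_
        have hsT : 0 < √(T : ℝ) := Real.sqrt_pos.2 hT0
        have hroot : √(T : ℝ) ≤ 20 * D ^ 2 * √(D : ℝ) / c := by
          apply Real.sqrt_le_iff.2 ⟨by positivity, hsmall.trans (le_of_eq ?_)⟩
          rw [div_pow, mul_pow, Real.sq_sqrt (by positivity)]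
          ring
        calc (D : ℝ) = D * √(T : ℝ) / √(T : ℝ) := by field_simp
          _ ≤ D * (20 * D ^ 2 * √(D : ℝ) / c) / √(T : ℝ) := by gcongr
          _ = 10 / c * ((1 / √(T : ℝ)) * (2 * ((D : ℝ) ^ 3 * √(D : ℝ)) + 0)) := by
            field_simp; ring
          _ ≤ _ := by gcongr; positivity
      rw [Measure.real, ENNReal.toReal_eq_one_iff]
      exact (measure_congr (Filter.eventuallyEq_univ.2 hae)).trans measure_univ
    rw [hone]
    have : (0 : ℝ) ≤ 1 / (T : ℝ) ^ 3 := by positivity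
    linarith
  · rw [not_le] at hsmall
    have hc2 : c ^ 2 ≤ c := by nlinarith
    have hbig : 400 * (D : ℝ) ^ 5 / c ^ 2 ≥ 400 * D / c := by
      have : (D : ℝ) ≤ D ^ 5 := le_self_pow₀ (by linarith) (by norm_num)
      have hc2' : 0 < c ^ 2 := by positivity
      show 400 * D / c ≤ _
      gcongr
    have hDc : (D : ℝ) ≤ D / c := by rw [le_div_iff₀ hc0]; nlinarith
    have h400 : 400 * ((D : ℝ) / c) ≤ T := by
      have : 400 * ((D : ℝ) / c) = 400 * D / c := by ring
      linarith
    have hT12 : (12 : ℝ) ≤ T := by linarith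
    have hDT : (D : ℝ) ≤ T := by linarith
    have hβT : (D : ℝ) / c ≤ T := by linarith
    have hlog1 : 1 ≤ Real.log T := by
      rw [Real.le_log_iff_exp_le hT0]
      linarith [Real.exp_one_lt_d9]
    set l := 20 * (Nat.log 2 T + 1) with hl
    have hTl : (T : ℝ) ^ 20 ≤ 2 ^ l := by
      have h1 : T ≤ 2 ^ (Nat.log 2 T + 1) := (Nat.lt_pow_succ_log_self (by norm_num) T).le
      have h2 : (T : ℝ) ≤ 2 ^ (Nat.log 2 T + 1) := by exact_mod_cast h1
      calc (T : ℝ) ^ 20 ≤ (2 ^ (Nat.log 2 T + 1)) ^ 20 := by gcongr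
        _ = 2 ^ l := by rw [← pow_mul, hl, mul_comm]
    obtain ⟨enc, dec, hcode⟩ := NewtonState.exists_encoding D l
    have henc : ∀ s : NewtonState D, (∀ i, |(s.1 i : ℝ)| ≤ (T : ℝ) ^ 20) →
        (∀ i j, |(s.2 i j : ℝ)| ≤ (T : ℝ) ^ 20) → dec (enc s) = s := fun s h1 h2 =>
      hcode s (fun i => by exact_mod_cast (h1 i).trans hTl)
        (fun i j => by exact_mod_cast (h2 i j).trans hTl)
    refine ⟨_, newtonLearner ((T : ℝ) ^ 9) (D / c) (ν.real (Set.Ioi m)) m enc dec, ?_, ?_⟩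
    · have hnlog : (Nat.log 2 T : ℝ) ≤ 2 * Real.log T := by
        have h1 : ((2 ^ Nat.log 2 T : ℕ) : ℝ) ≤ T := by
          exact_mod_cast Nat.pow_log_le_self 2 (by omega)
        have h2 := Real.log_le_log (by positivity) h1
        push_cast at h2
        rw [Real.log_pow] at h2
        nlinarith [Real.log_two_gt_d9, Nat.cast_nonneg (α := ℝ) (Nat.log 2 T)]
      rw [hl]
      push_cast
      -- Origin of `62`: the left side is at most `40 * log T + 22`, and `log T ≥ 1` here.
      have h2 : (20 * ((Nat.log 2 T : ℝ) + 1) + 2) ≤ 62 * Real.log T := by linarith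
      calc (20 * ((Nat.log 2 T : ℝ) + 1) + 2) * (D + D * D)
          ≤ 62 * Real.log T * (D + D * D) := by gcongr
        _ = _ := by ring
    · intro w hw 𝒟 _ h𝒟 B p r hp hp0 hr
      have hle := hmain hp0 (hp ▸ minCapProb_le_one hd 𝒟 B _) hr
      have hcube : ∀ᵐ q ∂𝒟, InUnitCube q := h𝒟.mono fun q hq => hq.2.1
      have hprob : IsProbabilityMeasure (streamLaw T 𝒟 ν) := by
        unfold streamLaw; infer_instance
      set A := newtonLearner ((T : ℝ) ^ 9) (D / c) (ν.real (Set.Ioi m)) m enc dec with hA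
      have htail := newtonLearner_sum_sq_error_tail henc ν hc0 hc1 rfl hdecay (by omega) hT12 hDT
        rfl rfl hβT hw 𝒟 hcube
      rw [← hA] at htail
      set b := 10 / c * ((1 / √(T : ℝ)) *
          (r * (D : ℝ) ^ (7 / 2 : ℝ) * d + √(D : ℝ) * Real.log T)) with hb
      have hb0 : 0 ≤ b := by
        have h1 : 0 ≤ r * (D : ℝ) ^ (7 / 2 : ℝ) * d := le_trans (by positivity) hle
        positivity
      have hbound := sum_sq_bound_le hD2 hT1 hc0 hc1 hlog1 hle
      have hcompl : (streamLaw T 𝒟 ν).real {x | A.averageError w x ≤ b}ᶜ ≤ 1 / (T : ℝ) ^ 3 := by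
        refine ENNReal.toReal_le_of_le_ofReal (by positivity) (le_trans (measure_mono ?_) htail)
        intro x hx
        rw [Set.mem_ofPred_eq]
        by_contra hcon
        exact hx (averageError_le_of_sum_sq_le A w x hb0 ((not_le.1 hcon).le.trans hbound))
      -- Subadditivity suffices, so measurability of the event need not be checked.
      have hunion : 1 ≤ (streamLaw T 𝒟 ν).real {x | A.averageError w x ≤ b}
          + (streamLaw T 𝒟 ν).real {x | A.averageError w x ≤ b}ᶜ := by
        have := measureReal_union_le (μ := streamLaw T 𝒟 ν) {x | A.averageError w x ≤ b}
          {x | A.averageError w x ≤ b}ᶜ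
        rwa [Set.union_compl_self, probReal_univ] at this
      linarith
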